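/- Let $C$ be a layered arithmetic circuit of fan-in two with arbitrary wiring: it has $d$ layers, layer $1$ is the output layer and layer $d$ the input layer, every gate of layer $i<d$ adds or multiplies the values of two (not necessarily distinct) gates of layer $i+1$, and the number of gates of each layer is a power of two. Let $2^{s_1}$ be the number of output gates, $n$ the number of inputs, and $S\ge 2$ the total number of gates, input gates included. Let $B=2^b$, and let $C^*$ consist of $B$ copies of $C$ laid side by side, so that $C^*$ has $n^*=Bn$ inputs, $BS$ gates and $2^{s_1+b}$ output gates. For a finite field $\mathbb F$ and an input $x\in\mathbb F^{n^*}$ let $V_1^*:\{0,1\}^{s_1+b}\to\mathbb F$ be the function that maps the label of an output gate of $C^*$ to the value of that gate on $x$, and let $\tilde V_1^*$ be its multilinear extension, that is, the unique polynomial over $\mathbb F$ in $s_1+b$ variables, of degree at most one in each variable, that agrees with $V_1^*$ on $\{0,1\}^{s_1+b}$. Both parties are straight-line programs over registers holding field elements. One step is one addition, subtraction or multiplication in $\mathbb F$, or setting a register to $0$ or $1$, reading one entry of the input or one coordinate of $z$, reading one uniformly random element of $\mathbb F$ (verifier only), sending or receiving one element of $\mathbb F$, or one equality test that makes the verifier reject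 if it fails. A verifier $\mathcal V$ and a prover $\mathcal P$ form a valid interactive proof protocol for a function $f$ if, for every input $x$, $\mathcal V$ outputs $f(x)$ with probability $1$ when interacting with $\mathcal P$, and, for every input $x$ and every computationally unbounded prover $\mathcal P'$, $\mathcal V$ outputs a value other than $f(x)$ and $\perp$ (rejection) with probability at most $1/3$. There are absolute constants for which the following holds. For every such $C$ and $B$ there are programs $\mathcal V$ and $\mathcal P$ such that, for every finite field $\mathbb F$ whose size is at least a sufficiently large absolute constant times $d\log(BS)$ and every point $z\in\mathbb F^{s_1+b}$ (known to both parties), $(\mathcal P,\mathcal V)$ is a valid interactive proof protocol for the function that maps $x\in\mathbb F^{n^*}$ to $\tilde V_1^*(z)$. The costs are as follows. $\mathcal V$ spends $O(S)$ time in a pre-processing phase, in which it sees its random field elements but neither $x$ nor $z$ nor any message, and $O(n^*\log n^*+d\log(BS))$ time in an online verification phase. $\mathcal P$ runs in total time $O(S\cdot B\cdot\log S)$. The total communication, in both directions, is $O(d\log(BS))$ field elements. The constants in all these bounds are absolute. -/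

import Mathlib

namespace DataParallel

/-! ### Layered arithmetic circuits -/

/-- Binary gate labels with `k` bits. -/
abbrev Label (k : ℕ) : Type := Fin k → Bool

/-- Layered arithmetic circuits of fan-in two, with arbitrary wiring, with `2 ^ n` inputs and `2 ^ s`
gates in the output layer.  The number of gates of every layer is a power of two.
`input` is the circuit that consists of the input layer only.  `layer mul in₁ in₂ C` puts a new output
layer with `2 ^ s` gates on top of `C`: gate `p` multiplies (if `mul p`) or adds (otherwise) the values
of the gates `in₁ p` and `in₂ p` of the output layer of `C`. -/
inductive Circuit (n : ℕ) : ℕ → Type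
  | input : Circuit n n
  | layer {s t : ℕ} (mul : Label s → Bool) (in₁ in₂ : Label s → Label t) (C : Circuit n t) :
      Circuit n s

namespace Circuit

/-- Number of layers, the input layer included. -/
def depth {n : ℕ} : {s : ℕ} → Circuit n s → ℕ
  | _, input => 1
  | _, layer _ _ _ C => C.depth + 1

/-- Total number of gates, the input gates included. -/
def size {n : ℕ} : {s : ℕ} → Circuit n s → ℕ
  | _, input => 2 ^ n
  | s, layer _ _ _ C => 2 ^ s + C.size

/-- The values of the gates of the output layer on input `x`. -/
def eval {F : Type*} [Field F] {n : ℕ} : {s : ℕ} → Circuit n s → (Label n → F) → Label s → F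
  | _, input, x => x
  | _, layer mul in₁ in₂ C, x => fun p =>
      if mul p then C.eval x (in₁ p) * C.eval x (in₂ p) else C.eval x (in₁ p) + C.eval x (in₂ p)

end Circuit

/-- The part of the label `(p₁, p₂)` that names the gate within a copy. -/
def gatePart {s b : ℕ} (p : Label (s + b)) : Label s := fun i => p (Fin.castAdd b i)

/-- The part of the label `(p₁, p₂)` that names the copy. -/
def copyPart {s b : ℕ} (p : Label (s + b)) : Label b := fun i => p (Fin.natAdd s i)

/-- `C.copies b` consists of `2 ^ b` copies of `C`, laid side by side.  Gate `(p₁, p₂)` of a layer is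
gate `p₁` of that layer in copy number `p₂`. -/
def Circuit.copies {n : ℕ} (b : ℕ) : {s : ℕ} → Circuit n s → Circuit (n + b) (s + b)
  | _, .input => .input
  | _, .layer mul in₁ in₂ C =>
      .layer (fun p => mul (gatePart p))
        (fun p => Fin.append (in₁ (gatePart p)) (copyPart p))
        (fun p => Fin.append (in₂ (gatePart p)) (copyPart p))
        (C.copies b)

theorem Circuit.depth_copies {n : ℕ} (b : ℕ) {s : ℕ} (C : Circuit n s) :
    (C.copies b).depth = C.depth := by
  induction C with
  | input => rfl
  | layer mul in₁ in₂ C ih => simp [Circuit.copies, Circuit.depth, ih]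

theorem Circuit.size_copies {n : ℕ} (b : ℕ) {s : ℕ} (C : Circuit n s) :
    (C.copies b).size = 2 ^ b * C.size := by
  induction C with
  | input => simp [Circuit.copies, Circuit.size, pow_add, mul_comm]
  | layer mul in₁ in₂ C ih => simp [Circuit.copies, Circuit.size, ih, pow_add, mul_add, mul_comm]

theorem Circuit.eval_copies {F : Type*} [Field F] {n : ℕ} (b : ℕ) {s : ℕ} (C : Circuit n s)
    (x : Label (n + b) → F) (p₁ : Label s) (p₂ : Label b) :
    (C.copies b).eval x (Fin.append p₁ p₂) = C.eval (fun j => x (Fin.append j p₂)) p₁ := by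
  induction C with
  | input => rfl
  | layer mul in₁ in₂ C ih =>
      have h₁ : gatePart (Fin.append p₁ p₂) = p₁ := by funext i; simp [gatePart]
      have h₂ : copyPart (Fin.append p₁ p₂) = p₂ := by funext i; simp [copyPart]
      simp [Circuit.copies, Circuit.eval, h₁, h₂, ih]

/-! ### Multilinear extensions -/

/-- The value at `z` of the multilinear extension of `V : {0,1}^k → F`. -/
def mle {F : Type*} [Field F] {k : ℕ} (V : Label k → F) (z : Fin k → F) : F :=
  ∑ p : Label k, V p * ∏ i, (if p i then z i else 1 - z i)

/-- The multilinear extension of `V`, as a polynomial. -/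
noncomputable def mlePoly {F : Type*} [Field F] {k : ℕ} (V : Label k → F) :
    MvPolynomial (Fin k) F :=
  ∑ p : Label k, MvPolynomial.C (V p) *
    ∏ i, (if p i then MvPolynomial.X i else 1 - MvPolynomial.X i)

theorem eval_mlePoly {F : Type*} [Field F] {k : ℕ} (V : Label k → F) (z : Fin k → F) :
    MvPolynomial.eval z (mlePoly V) = mle V z := by
  simp only [mlePoly, mle, map_sum, map_mul, map_prod, MvPolynomial.eval_C]
  refine Finset.sum_congr rfl fun p _ => congrArg _ (Finset.prod_congr rfl fun i _ => ?_)
  split <;> simp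

/-- `mle V` agrees with `V` on Boolean points. -/
theorem mle_boolean {F : Type*} [Field F] {k : ℕ} (V : Label k → F) (p : Label k) :
    mle V (fun i => if p i then 1 else 0) = V p := by
  unfold mle
  rw [Finset.sum_eq_single p]
  · rw [Finset.prod_eq_one, mul_one]
    intro i _
    cases h : p i <;> simp [h]
  · intro q _ hq
    obtain ⟨i, hi⟩ := Function.ne_iff.mp hq
    rw [Finset.prod_eq_zero (Finset.mem_univ i), mul_zero]
    cases h : p i <;> cases h' : q i <;> simp_all
  · simp

/-- `mle V` is given by a polynomial of degree at most one in each variable. -/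
theorem degreeOf_mlePoly_le {F : Type*} [Field F] {k : ℕ} (V : Label k → F) (i : Fin k) :
    (mlePoly V).degreeOf i ≤ 1 := by
  classical
  unfold mlePoly
  refine (MvPolynomial.degreeOf_sum_le _ _ _).trans (Finset.sup_le fun p _ => ?_)
  refine (MvPolynomial.degreeOf_C_mul_le _ _ _).trans ?_
  refine (MvPolynomial.degreeOf_prod_le _ _ _).trans ?_
  rw [Finset.sum_eq_single i]
  · split
    · simp
    · refine (MvPolynomial.degreeOf_sub_le _ _ _).trans ?_
      simp
  · intro j _ hj
    split
    · simp [MvPolynomial.degreeOf_X, hj.symm]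
    · refine Nat.le_zero.mp ((MvPolynomial.degreeOf_sub_le _ _ _).trans ?_)
      simp [MvPolynomial.degreeOf_X, hj.symm]
  · simp

/-- `mle V` is the only such polynomial function. -/
theorem eval_eq_mle {F : Type*} [Field F] {k : ℕ} (V : Label k → F) (q : MvPolynomial (Fin k) F)
    (hq : ∀ i, q.degreeOf i ≤ 1)
    (hV : ∀ p : Label k, MvPolynomial.eval (fun i => if p i then 1 else 0) q = V p)
    (z : Fin k → F) : MvPolynomial.eval z q = mle V z := by
  classical
  have h : q - mlePoly V = 0 := by
    refine MvPolynomial.eq_zero_of_eval_zero_at_prod_finset _ (fun _ => {0, 1}) (fun i => ?_)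
      (fun a ha => ?_)
    · rw [Finset.card_pair zero_ne_one]
      exact lt_of_le_of_lt (MvPolynomial.degreeOf_sub_le _ _ _)
        (lt_of_le_of_lt (max_le (hq i) (degreeOf_mlePoly_le V i)) one_lt_two)
    · have h' : a = fun i => if (decide (a i = 1)) then 1 else 0 := by
        funext i
        have := ha i
        simp only [Finset.mem_insert, Finset.mem_singleton] at this
        rcases this with h0 | h1 <;> simp [*]
      rw [h', map_sub, hV, eval_mlePoly, mle_boolean, sub_self]
  rw [← eval_mlePoly, sub_eq_zero.mp h]

/-! ### Interactive programs and their step counts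

Both parties run straight-line programs over registers that hold field elements and are initially `0`.
Each instruction performs one operation and costs one step: a field operation, reading one entry of
the input `x` or one coordinate of the point `z`, reading one random field element, sending or
receiving one field element, or one equality test.  The only constants are `0` and `1`, so that a
program makes sense over every field.  Below, `N` is the number of bits of an input label, `k` the
number of coordinates of `z`, and `m` the number of random field elements of the verifier. -/

/-- Arithmetic instructions; the first argument is the target register. -/
inductive Arith : Type
  | const (dst : ℕ) (c : Bool)
  | add (dst a b : ℕ)
  | sub (dst a b : ℕ)
  | mul (dst a b : ℕ)

/-- The effect of an arithmetic instruction on the registers. -/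
def Arith.exec {F : Type*} [Field F] (ρ : ℕ → F) : Arith → ℕ → F
  | const dst c => Function.update ρ dst (if c then 1 else 0)
  | add dst a b => Function.update ρ dst (ρ a + ρ b)
  | sub dst a b => Function.update ρ dst (ρ a - ρ b)
  | mul dst a b => Function.update ρ dst (ρ a * ρ b)

/-- Instructions of the verifier in the pre-processing phase: she has access to her random field
elements, but neither to `x`, nor to `z`, nor to the prover. -/
inductive PreInstr (m : ℕ) : Type
  | arith (o : Arith)
  | coin (dst : ℕ) (j : Fin m)

/-- The effect of a pre-processing instruction on the registers; `R` are the random elements. -/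
def PreInstr.exec {F : Type*} [Field F] {m : ℕ} (R : Fin m → F) (ρ : ℕ → F) : PreInstr m → ℕ → F
  | arith o => o.exec ρ
  | coin dst j => Function.update ρ dst (R j)

/-- Instructions of the verifier in the online phase.  `check a b` rejects unless the registers `a`
and `b` hold the same value. -/
inductive VInstr (N k m : ℕ) : Type
  | arith (o : Arith)
  | coin (dst : ℕ) (j : Fin m)
  | input (dst : ℕ) (j : Label N)
  | point (dst : ℕ) (j : Fin k)
  | send (a : ℕ)
  | recv (dst : ℕ)
  | check (a b : ℕ)

/-- Instructions of the honest prover. -/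
inductive PInstr (N k : ℕ) : Type
  | arith (o : Arith)
  | input (dst : ℕ) (j : Label N)
  | point (dst : ℕ) (j : Fin k)
  | send (a : ℕ)
  | recv (dst : ℕ)

/-- The behaviour of an arbitrary, computationally unbounded prover on a fixed input: `σ h i` is the
`i`-th field element (counted from `0`) that it sends, when `h` is the list of the field elements that
it has received by then, in the order in which they were sent. -/
abbrev Strategy (F : Type*) : Type _ := List F → ℕ → F

/-- State of the verifier: registers, the field elements sent so far (in order), and the number of
field elements received so far. -/
structure VState (F : Type*) where
  reg : ℕ → F
  sent : List F
  rcvd : ℕ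

open Classical in
/-- One online step of the verifier against the strategy `σ`; `none` means that she rejects. -/
noncomputable def VInstr.step {F : Type*} [Field F] {N k m : ℕ} (z : Fin k → F) (x : Label N → F)
    (R : Fin m → F) (σ : Strategy F) (st : VState F) : VInstr N k m → Option (VState F)
  | arith o => some { st with reg := o.exec st.reg }
  | coin dst j => some { st with reg := Function.update st.reg dst (R j) }
  | input dst j => some { st with reg := Function.update st.reg dst (x j) }
  | point dst j => some { st with reg := Function.update st.reg dst (z j) }
  | send a => some { st with sent := st.sent ++ [st.reg a] }
  | recv dst => some { st with
      reg := Function.update st.reg dst (σ st.sent st.rcvd)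
      rcvd := st.rcvd + 1 }
  | check a b => if st.reg a = st.reg b then some st else none

/-- A verifier: the number of her random field elements, her pre-processing program, and her online
program, which starts with the registers as the pre-processing has left them. -/
structure Verifier (N k : ℕ) where
  coins : ℕ
  pre : List (PreInstr coins)
  online : List (VInstr N k coins)

namespace Verifier

variable {N k : ℕ}

/-- The output of the verifier: the content of register `0` at the end, or `none` (that is, `⊥`) if
she has rejected. -/
noncomputable def out {F : Type*} [Field F] (V : Verifier N k) (z : Fin k → F) (x : Label N → F)
    (R : Fin V.coins → F) (σ : Strategy F) : Option F :=
  (V.online.foldlM (VInstr.step z x R σ)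
    ⟨V.pre.foldl (PreInstr.exec R) (fun _ => 0), [], 0⟩).map (fun st => st.reg 0)

/-- Number of steps of the pre-processing phase. -/
def preTime (V : Verifier N k) : ℕ := V.pre.length

/-- Number of steps of the online phase. -/
def onlineTime (V : Verifier N k) : ℕ := V.online.length

/-- Number of field elements that the two parties exchange, in both directions. -/
def communication (V : Verifier N k) : ℕ :=
  V.online.countP fun i => match i with
    | .send _ => true
    | .recv _ => true
    | _ => false

end Verifier

/-- Program of an honest prover. -/
abbrev ProverProgram (N k : ℕ) : Type := List (PInstr N k)

namespace ProverProgram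

variable {N k : ℕ}

/-- The list of field elements sent when the program is run with registers `ρ` and the list `h` of
messages from the verifier, up to the point where it waits for a message that has not come yet. -/
def run {F : Type*} [Field F] (z : Fin k → F) (x : Label N → F) :
    ProverProgram N k → (ρ : ℕ → F) → (h : List F) → List F
  | [], _, _ => []
  | .arith o :: is, ρ, h => run z x is (o.exec ρ) h
  | .input dst j :: is, ρ, h => run z x is (Function.update ρ dst (x j)) h
  | .point dst j :: is, ρ, h => run z x is (Function.update ρ dst (z j)) h
  | .send a :: is, ρ, h => ρ a :: run z x is ρ h
  | .recv _ :: _, _, [] => []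
  | .recv dst :: is, ρ, r :: h => run z x is (Function.update ρ dst r) h

/-- The strategy of the program on input `x`; a message that the program does not send is read
as `0`. -/
def strategy {F : Type*} [Field F] (P : ProverProgram N k) (z : Fin k → F) (x : Label N → F) :
    Strategy F :=
  fun h i => (P.run z x (fun _ => 0) h).getD i 0

/-- Total number of steps of the prover. -/
def time (P : ProverProgram N k) : ℕ := P.length

end ProverProgram

/-! ### Valid interactive proofs -/

/-- Probability of `E` when `R` is uniform on `F ^ m`. -/
noncomputable def prob {F : Type*} {m : ℕ} (E : (Fin m → F) → Prop) : ℝ :=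
  (Nat.card {R : Fin m → F // E R} : ℝ) / (Nat.card (Fin m → F) : ℝ)

section Valid

variable {F : Type*} [Field F] {N k : ℕ}

/-- The prover `P` is valid with respect to `V`, for the function `f` (`z` is known to both). -/
def IsValidProver (V : Verifier N k) (z : Fin k → F) (f : (Label N → F) → F)
    (P : (Label N → F) → Strategy F) : Prop :=
  ∀ x, prob (fun R => V.out z x R (P x) = some (f x)) = 1

/-- `V` is a valid verifier for `f` with soundness probability `δ`. -/
def IsValidVerifier (V : Verifier N k) (z : Fin k → F) (f : (Label N → F) → F) (δ : ℝ) : Prop :=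
  (∃ P : (Label N → F) → Strategy F, IsValidProver V z f P) ∧
    ∀ (P' : (Label N → F) → Strategy F) (x : Label N → F),
      prob (fun R => V.out z x R (P' x) ≠ some (f x) ∧ V.out z x R (P' x) ≠ none) ≤ δ

/-- `(P, V)` is a valid interactive proof protocol for `f`. -/
def IsValidProtocol (P : (Label N → F) → Strategy F) (V : Verifier N k) (z : Fin k → F)
    (f : (Label N → F) → F) : Prop :=
  IsValidVerifier V z f (1 / 3) ∧ IsValidProver V z f P

end Valid

end DataParallel

/-!
The protocol treats one layer after the other and keeps a single claim: the value at one point `z` of the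
multilinear extension of the gate values of the current layer.  All gates are summed over densely, as entries
of tables indexed by labels, so that the wiring enters only through tables that are known in advance.

For a layer with gate types `mul` and wirings `in₁`, `in₂`, let `L` and `R` be the tables of the values of the
two inputs of gate `(p₁, p₂)`.  The claim is about `∑ p, eqWeight z p * (mul ? L p * R p : L p + R p)`, a sum of
values of the gate formula `phi`, and the sum-check protocol (`Inv.sumcheck`) turns it into claims about the
extensions of `L` and `R` at a random point `(r, c)`.  A further coin `γ` combines these two into one claim, and
since `L` and `R` are entries of the next layer picked by the wiring, this is again a sum of the same shape, over
the gates `ω` of the next layer in the copy point `c`, with weights `pullWeight in₁ r ω + γ * pullWeight in₂ r ω`.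
A second sum-check ends with a claim about a single point of the next layer (`Inv.layer`).  The verifier
evaluates the extension of the input herself.

The extensions of `mul` and of the weights at the points that come up depend on her coins only, so they can be
prepared in time linear in the size of one copy (`Pre.advice`).  The prover binds the variables one by one, which
halves his tables each time, so that a sum-check costs him time linear in the table size.

Programs are never written down.  The content of a register is a symbolic value `Val`, a field element for
each execution `Env`.  Symbolic values form a commutative ring, so costs are straight-line complexities over a
ring (`Comp`), and the predicates `Pre`, `Online`, and `PRun` say that program prefixes exist that store given
values.  The invariant `Inv` ties the two parties together: it carries costs, completeness, and soundness.
All interaction goes through `Inv.exchange`: the prover sends the coefficients of a polynomial of degree below `j`,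
the verifier checks it against the current claim and goes on to its value at a fresh coin.  If the
claim is false, the polynomial sent is the wrong one, and it agrees with the right one at the coin with
probability at most `j / |F|`.  Adding this up over all coins bounds the soundness error (`Inv.finish`).
-/

namespace DataParallel

universe u
/-! ### Multilinear extensions over a commutative ring -/

theorem range_tail_subset {P : Type*} {k : ℕ} (z : Fin (k + 1) → P) :
    Set.range (Fin.tail z : Fin k → P) ⊆ Set.range z :=
  Set.range_subset_iff.mpr fun i => ⟨i.succ, rfl⟩

section Multilinear

variable {P : Type*} [CommRing P]

/-- The weight of the Boolean point `p` in the multilinear extension at `z`.  Over a field it is the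
value at `(z, p)` of the multilinear extension of the equality predicate. -/
def eqWeight {k : ℕ} (z : Fin k → P) (p : Label k) : P := ∏ i, if p i then z i else 1 - z i

/-- The value at `z` of the multilinear extension of `T`.  It is `mle`, stated for commutative rings, so
that it applies to tables of symbolic values. -/
def extend {k : ℕ} (T : Label k → P) (z : Fin k → P) : P := ∑ p, T p * eqWeight z p

/-- The table that arises from `T` when the first variable is bound to `r`. -/
def bind {k : ℕ} (T : Label (k + 1) → P) (r : P) (p : Label k) : P :=
  T (Fin.cons false p) + r * (T (Fin.cons true p) - T (Fin.cons false p))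

theorem sum_label_succ {k : ℕ} (f : Label (k + 1) → P) :
    ∑ p, f p = ∑ p : Label k, (f (Fin.cons false p) + f (Fin.cons true p)) := by
  rw [← (Fin.consEquiv (fun _ : Fin (k + 1) => Bool)).sum_comp, Fintype.sum_prod_type]
  simp [Fin.consEquiv, Finset.sum_add_distrib, add_comm]

theorem sum_label_add {s b : ℕ} (f : Label (s + b) → P) :
    ∑ p, f p = ∑ p₁ : Label s, ∑ p₂ : Label b, f (Fin.append p₁ p₂) := by
  rw [← (Fin.appendEquiv s b).sum_comp, Fintype.sum_prod_type]
  rfl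

theorem eqWeight_cons {k : ℕ} (z : Fin (k + 1) → P) (a : Bool) (p : Label k) :
    eqWeight z (Fin.cons a p) = (if a then z 0 else 1 - z 0) * eqWeight (Fin.tail z) p := by
  simp [eqWeight, Fin.prod_univ_succ, Fin.tail]

theorem eqWeight_append {s b : ℕ} (u : Fin s → P) (w : Fin b → P) (p₁ : Label s) (p₂ : Label b) :
    eqWeight (Fin.append u w) (Fin.append p₁ p₂) = eqWeight u p₁ * eqWeight w p₂ := by
  simp [eqWeight, Fin.prod_univ_add]

theorem extend_bind {k : ℕ} (T : Label (k + 1) → P) (z : Fin (k + 1) → P) :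
    extend (bind T (z 0)) (Fin.tail z) = extend T z := by
  unfold extend
  rw [sum_label_succ]
  refine Finset.sum_congr rfl fun p _ => ?_
  simp only [eqWeight_cons, bind]
  simp
  ring

theorem extend_append {s b : ℕ} (T : Label (s + b) → P) (u : Fin s → P) (w : Fin b → P) :
    extend T (Fin.append u w) = extend (fun p₁ => extend (fun p₂ => T (Fin.append p₁ p₂)) w) u := by
  unfold extend
  rw [sum_label_add]
  refine Finset.sum_congr rfl fun p₁ _ => ?_
  rw [Finset.sum_mul]
  refine Finset.sum_congr rfl fun p₂ _ => ?_
  rw [eqWeight_append]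
  ring

theorem extend_zero_vars (T : Label 0 → P) (z : Fin 0 → P) : extend T z = T default := by
  rw [extend, Fintype.sum_unique, eqWeight, Finset.univ_eq_empty, Finset.prod_empty, mul_one]
  exact congrArg T (Subsingleton.elim _ _)

theorem sum_eqWeight {k : ℕ} (z : Fin k → P) : ∑ p, eqWeight z p = 1 := by
  induction k with
  | zero => simp [eqWeight]
  | succ k ih =>
    rw [sum_label_succ, ← ih (Fin.tail z)]
    refine Finset.sum_congr rfl fun p _ => ?_
    simp [eqWeight_cons]
    ring

theorem extend_const {k : ℕ} (a : P) (z : Fin k → P) : extend (fun _ => a) z = a := by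
  rw [extend, ← Finset.mul_sum, sum_eqWeight, mul_one]

/-- The multilinear extension of the equality predicate as a product. -/
theorem extend_eqWeight {k : ℕ} (z r : Fin k → P) :
    extend (eqWeight z) r = ∏ i, (z i * r i + (1 - z i) * (1 - r i)) := by
  induction k with
  | zero => simp [extend_zero_vars, eqWeight]
  | succ k ih =>
    rw [Fin.prod_univ_succ]
    have := ih (Fin.tail z) (Fin.tail r)
    simp only [Fin.tail] at this
    rw [← this]
    unfold extend
    rw [sum_label_succ, Finset.mul_sum]
    refine Finset.sum_congr rfl fun p _ => ?_
    simp only [eqWeight_cons]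
    simp
    unfold Fin.tail
    ring

/-- The weight with which the entry `ω` of a table `T` enters `extend (T ∘ f) r`. -/
def pullWeight {s u : ℕ} (f : Label s → Label u) (r : Fin s → P) (ω : Label u) : P :=
  ∑ p with f p = ω, eqWeight r p

theorem extend_comp {s u : ℕ} (f : Label s → Label u) (r : Fin s → P) (T : Label u → P) :
    extend (fun p => T (f p)) r = ∑ ω, pullWeight f r ω * T ω := by
  simp only [extend, pullWeight, Finset.sum_mul]
  rw [← Finset.sum_fiberwise (s := Finset.univ) (g := f)]
  refine Finset.sum_congr rfl fun ω _ => Finset.sum_congr rfl fun p hp => ?_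
  rw [(Finset.mem_filter.mp hp).2, mul_comm]

theorem extend_pullWeight {s u : ℕ} (f : Label s → Label u) (r : Fin s → P) (r' : Fin u → P) :
    extend (pullWeight f r) r' = extend (fun p => eqWeight r' (f p)) r := by
  rw [extend_comp f r (eqWeight r')]
  rfl

theorem extend_add_mul {k : ℕ} (T U : Label k → P) (a : P) (z : Fin k → P) :
    extend (fun p => T p + a * U p) z = extend T z + a * extend U z := by
  simp only [extend, Finset.mul_sum, ← Finset.sum_add_distrib]
  exact Finset.sum_congr rfl fun p _ => by ring

end Multilinear

/-! ### Straight-line computations -/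

section StraightLine

variable {P : Type*} [CommRing P]

/-- `SL A c B`: a sequence of `c` ring operations that starts from the elements of `A` yields exactly
the elements of `B`, those of `A` included. -/
inductive SL (A : Set P) : ℕ → Set P → Prop
  | nil : SL A 0 A
  | const {c : ℕ} {B : Set P} (a : Bool) : SL A c B → SL A (c + 1) (insert (if a then 1 else 0) B)
  | add {c : ℕ} {B : Set P} {u v : P} : SL A c B → u ∈ B → v ∈ B → SL A (c + 1) (insert (u + v) B)
  | sub {c : ℕ} {B : Set P} {u v : P} : SL A c B → u ∈ B → v ∈ B → SL A (c + 1) (insert (u - v) B)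
  | mul {c : ℕ} {B : Set P} {u v : P} : SL A c B → u ∈ B → v ∈ B → SL A (c + 1) (insert (u * v) B)

theorem SL.subset {A B : Set P} {c : ℕ} (h : SL A c B) : A ⊆ B := by
  induction h with
  | nil => exact subset_rfl
  | const _ _ ih | add _ _ _ ih | sub _ _ _ ih | mul _ _ _ ih =>
    exact ih.trans (Set.subset_insert _ _)

theorem SL.union {A B : Set P} {c : ℕ} (h : SL A c B) (X : Set P) : SL (A ∪ X) c (B ∪ X) := by
  induction h with
  | nil => exact .nil
  | const a _ ih => rw [Set.insert_union]; exact ih.const a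
  | add _ hu hv ih => rw [Set.insert_union]; exact ih.add (.inl hu) (.inl hv)
  | sub _ hu hv ih => rw [Set.insert_union]; exact ih.sub (.inl hu) (.inl hv)
  | mul _ hu hv ih => rw [Set.insert_union]; exact ih.mul (.inl hu) (.inl hv)

theorem SL.trans {A B D : Set P} {c d : ℕ} (h : SL A c B) (h' : SL B d D) : SL A (c + d) D := by
  induction h' with
  | nil => exact h
  | const a _ ih => exact ih.const a
  | add _ hu hv ih => exact ih.add hu hv
  | sub _ hu hv ih => exact ih.sub hu hv
  | mul _ hu hv ih => exact ih.mul hu hv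

/-- The elements of `B` can be computed from those of `A` with at most `c` ring operations. -/
def Comp (A : Set P) (c : ℕ) (B : Set P) : Prop := ∃ c' ≤ c, ∃ D, SL A c' D ∧ B ⊆ D

namespace Comp

variable {A B D : Set P} {c d : ℕ} {u v : P}

theorem of_subset (h : B ⊆ A) : Comp A 0 B := ⟨0, le_rfl, A, .nil, h⟩

theorem le (h : Comp A c B) (hcd : c ≤ d) : Comp A d B :=
  let ⟨c', hc', D, hD⟩ := h
  ⟨c', hc'.trans hcd, D, hD⟩

theorem mono {A' B' : Set P} (h : Comp A c B) (hA : A ⊆ A') (hB : B' ⊆ B) : Comp A' c B' := by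
  obtain ⟨c', hc', D, hD, hBD⟩ := h
  refine ⟨c', hc', D ∪ A', ?_, hB.trans (hBD.trans Set.subset_union_left)⟩
  have := hD.union A'
  rwa [Set.union_eq_self_of_subset_left hA] at this

theorem trans (h : Comp A c B) (h' : Comp (A ∪ B) d D) : Comp A (c + d) (B ∪ D) := by
  obtain ⟨c', hc', X, hX, hBX⟩ := h
  obtain ⟨d', hd', Y, hY, hDY⟩ := h'
  refine ⟨c' + d', add_le_add hc' hd', Y ∪ X, hX.trans ?_, Set.union_subset
    (hBX.trans Set.subset_union_right) (hDY.trans Set.subset_union_left)⟩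
  have := hY.union X
  rwa [Set.union_eq_self_of_subset_left (Set.union_subset hX.subset hBX)] at this

theorem trans' (h : Comp A c B) (h' : Comp (A ∪ B) d D) : Comp A (c + d) D :=
  (h.trans h').mono subset_rfl Set.subset_union_right

theorem union (h : Comp A c B) (h' : Comp A d D) : Comp A (c + d) (B ∪ D) :=
  h.trans (h'.mono Set.subset_union_left subset_rfl)

theorem var (h : u ∈ A) : Comp A 0 {u} := of_subset (Set.singleton_subset_iff.mpr h)

theorem const (a : Bool) : Comp A 1 {(if a then 1 else 0 : P)} :=
  ⟨1, le_rfl, _, SL.nil.const a, by simp⟩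

theorem zero : Comp A 1 {(0 : P)} := const false

theorem one : Comp A 1 {(1 : P)} := const true

theorem add (h : Comp A c {u}) (h' : Comp A d {v}) : Comp A (c + d + 1) {u + v} :=
  (h.union h').trans' ⟨1, le_rfl, _, SL.nil.add (u := u) (v := v) (by simp) (by simp), by simp⟩

theorem sub (h : Comp A c {u}) (h' : Comp A d {v}) : Comp A (c + d + 1) {u - v} :=
  (h.union h').trans' ⟨1, le_rfl, _, SL.nil.sub (u := u) (v := v) (by simp) (by simp), by simp⟩

theorem mul (h : Comp A c {u}) (h' : Comp A d {v}) : Comp A (c + d + 1) {u * v} :=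
  (h.union h').trans' ⟨1, le_rfl, _, SL.nil.mul (u := u) (v := v) (by simp) (by simp), by simp⟩

theorem image {ι : Type*} (s : Finset ι) (f : ι → P) (c : ι → ℕ) (h : ∀ i ∈ s, Comp A (c i) {f i}) :
    Comp A (∑ i ∈ s, c i) (f '' s) := by
  classical
  induction s using Finset.induction_on with
  | empty => simpa using of_subset (Set.empty_subset A)
  | insert a s ha ih =>
    rw [Finset.sum_insert ha, Finset.coe_insert, Set.image_insert_eq, Set.insert_eq]
    exact (h a (by simp)).union (ih fun i hi => h i (by simp [hi]))

theorem range {ι : Type*} [Fintype ι] (f : ι → P) (h : ∀ i, Comp A c {f i}) :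
    Comp A (Fintype.card ι * c) (Set.range f) := by
  simpa using image Finset.univ f (fun _ => c) fun i _ => h i

theorem sum {ι : Type*} (s : Finset ι) (f : ι → P) (h : ∀ i ∈ s, Comp A c {f i}) :
    Comp A (s.card * (c + 1) + 1) {∑ i ∈ s, f i} := by
  classical
  induction s using Finset.induction_on with
  | empty => simpa using zero
  | insert a s ha ih =>
    rw [Finset.sum_insert ha, Finset.card_insert_of_notMem ha]
    exact ((h a (by simp)).add (ih fun i hi => h i (by simp [hi]))).le (by ring_nf; omega)

theorem prod {ι : Type*} (s : Finset ι) (f : ι → P) (h : ∀ i ∈ s, Comp A c {f i}) :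
    Comp A (s.card * (c + 1) + 1) {∏ i ∈ s, f i} := by
  classical
  induction s using Finset.induction_on with
  | empty => simpa using one
  | insert a s ha ih =>
    rw [Finset.prod_insert ha, Finset.card_insert_of_notMem ha]
    exact ((h a (by simp)).mul (ih fun i hi => h i (by simp [hi]))).le (by ring_nf; omega)

/-- Horner's rule. -/
theorem horner {r : P} (hr : r ∈ A) : ∀ {j : ℕ} (μ : Fin j → P), Set.range μ ⊆ A →
    Comp A (2 * j + 1) {∑ i, μ i * r ^ (i : ℕ)}
  | 0, _, _ => by simpa using zero
  | j + 1, μ, h => by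
    have ih := horner hr (Fin.tail μ) ((range_tail_subset μ).trans h)
    have e : ∑ i, μ i * r ^ (i : ℕ) = μ 0 + r * ∑ i, Fin.tail μ i * r ^ (i : ℕ) := by
      rw [Fin.sum_univ_succ, Finset.mul_sum]
      simp only [Fin.tail, Fin.val_zero, pow_zero, mul_one, Fin.val_succ]
      congr 1
      exact Finset.sum_congr rfl fun i _ => by ring
    rw [e]
    exact ((var (h (Set.mem_range_self _))).add ((var hr).mul ih)).le (by omega)

theorem bind {k : ℕ} {T : Label (k + 1) → P} {r : P} (hT : Set.range T ⊆ A) (hr : r ∈ A) :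
    Comp A (2 ^ k * 3) (Set.range (DataParallel.bind T r)) := by
  have := range (A := A) (c := 3) (DataParallel.bind T r) fun p =>
    (var (hT (Set.mem_range_self _))).add ((var hr).mul ((var (hT (Set.mem_range_self _))).sub (var (hT (Set.mem_range_self _)))))
  simpa using this

/-- Binding one variable after the other evaluates a multilinear extension in linear time. -/
theorem extend : ∀ {k : ℕ} {A : Set P} {T : Label k → P} {z : Fin k → P}, Set.range T ⊆ A →
    Set.range z ⊆ A → Comp A (2 ^ k * 3) {DataParallel.extend T z}
  | 0, A, T, z, hT, hz => by
    rw [extend_zero_vars]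
    exact (var (hT (Set.mem_range_self _))).le (by omega)
  | k + 1, A, T, z, hT, hz => by
    rw [← extend_bind]
    have h₁ := Comp.bind hT (hz (Set.mem_range_self 0))
    have h₂ := Comp.extend (A := A ∪ Set.range (DataParallel.bind T (z 0))) (z := Fin.tail z)
      Set.subset_union_right
      (((range_tail_subset z).trans hz).trans Set.subset_union_left)
    exact (h₁.trans' h₂).le (by ring_nf; omega)

theorem eqWeight : ∀ {k : ℕ} {A : Set P} {z : Fin k → P}, Set.range z ⊆ A →
    Comp A (2 ^ k * 4) (Set.range (DataParallel.eqWeight z)) := by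
  -- the slack `3` pays for the two operations that yield `1 - z 0`
  suffices H : ∀ {k : ℕ} {A : Set P} {z : Fin k → P}, Set.range z ⊆ A → ∃ c, c + 3 ≤ 2 ^ k * 4 ∧
      Comp A c (Set.range (DataParallel.eqWeight z)) by
    intro k A z h
    obtain ⟨c, hc, h'⟩ := H h
    exact h'.le (by omega)
  intro k
  induction k with
  | zero =>
    intro A z h
    refine ⟨1, by norm_num, one.mono subset_rfl ?_⟩
    rintro _ ⟨p, rfl⟩
    simp [DataParallel.eqWeight]
  | succ k ih =>
    intro A z h
    obtain ⟨c, hc, h₁⟩ := ih (A := A) (z := Fin.tail z)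
      ((range_tail_subset z).trans h)
    have h₂ : Comp A (0 + 0 + (1 + 0 + 1)) ({z 0} ∪ {1 - z 0}) :=
      (var (h (Set.mem_range_self _))).union (one.sub (var (h (Set.mem_range_self _))))
    have h₃ := (h₁.union h₂).trans' (d := Fintype.card (Label (k + 1)) * 1)
      (range (DataParallel.eqWeight z) fun p => ?_)
    · refine ⟨_, ?_, h₃⟩
      simp
      ring_nf at hc ⊢
      have := Nat.one_le_two_pow (n := k)
      omega
    · rw [← Fin.cons_self_tail p, eqWeight_cons]
      refine (Comp.mul (c := 0) (d := 0) (var ?_) (var ?_)).le (by norm_num)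
      · cases p 0 <;> simp
      · exact .inr (.inl ⟨_, rfl⟩)

theorem pullWeight {s w : ℕ} {A : Set P} (f : Label s → Label w) {r : Fin s → P}
    (h : Set.range (DataParallel.eqWeight r) ⊆ A) :
    Comp A (2 ^ s + 2 ^ w) (Set.range (DataParallel.pullWeight f r)) := by
  have h₁ := image (A := A) Finset.univ (DataParallel.pullWeight f r) _ fun ω _ =>
    sum (c := 0) {p | f p = ω} _ fun p _ => var (h (Set.mem_range_self p))
  have h₂ := Finset.card_eq_sum_card_fiberwise (f := f) (s := Finset.univ) (t := Finset.univ)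
    (by simp)
  simp only [zero_add, mul_one, Finset.sum_add_distrib, ← h₂] at h₁
  simpa using h₁

end Comp

end StraightLine

/-! ### Probability -/

section Probability

variable {F : Type*} {m : ℕ}

theorem prob_le_of_imp [Finite F] {E E' : (Fin m → F) → Prop} (h : ∀ R, E R → E' R) :
    prob E ≤ prob E' := by
  unfold prob
  gcongr
  exact Nat.card_le_card_of_injective (fun R : {R // E R} => (⟨R.1, h _ R.2⟩ : {R // E' R}))
    fun a b hab => Subtype.ext (congrArg (fun R => R.1) hab)

theorem prob_or_le [Finite F] (E E' : (Fin m → F) → Prop) :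
    prob (fun R => E R ∨ E' R) ≤ prob E + prob E' := by
  classical
  have := Fintype.ofFinite F
  unfold prob
  rw [← add_div]
  gcongr
  norm_cast
  simp only [Nat.card_eq_fintype_card]
  exact Fintype.card_subtype_or _ _

theorem prob_of_forall [Finite F] [Nonempty F] {E : (Fin m → F) → Prop} (h : ∀ R, E R) :
    prob E = 1 := by
  unfold prob
  rw [Nat.card_congr (Equiv.subtypeUnivEquiv h), div_self]
  exact_mod_cast Nat.card_pos.ne'

theorem prob_of_forall_not {E : (Fin m → F) → Prop} (h : ∀ R, ¬ E R) : prob E = 0 := by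
  have : IsEmpty {R // E R} := ⟨fun R => h _ R.2⟩
  simp [prob]

/-- A nonzero polynomial whose coefficients do not depend on the coin `t` rarely vanishes at that coin. -/
theorem prob_root_le [Field F] [Finite F] (t : Fin m) {j : ℕ} (D : (Fin m → F) → Fin j → F)
    (hD : ∀ R R', (∀ i, i ≠ t → R i = R' i) → D R = D R') :
    prob (fun R => D R ≠ 0 ∧ ∑ i, D R i * R t ^ (i : ℕ) = 0) ≤ (j : ℝ) / Nat.card F := by
  classical
  have := Fintype.ofFinite F
  set E : (Fin m → F) → Prop := fun R => D R ≠ 0 ∧ ∑ i, D R i * R t ^ (i : ℕ) = 0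
  let f : (Fin m → F) → ({i // i ≠ t} → F) := fun R i => R i
  have hfib : ∀ a ∈ (Finset.univ.filter E).image f, ((Finset.univ.filter E).filter (f · = a)).card ≤ j := by
    intro a ha
    obtain ⟨R₀, hR₀, rfl⟩ := Finset.mem_image.mp ha
    have hE₀ : E R₀ := (Finset.mem_filter.mp hR₀).2
    let q : Polynomial F := ∑ i : Fin j, Polynomial.monomial i.1 (D R₀ i)
    have hcoeff : ∀ i : Fin j, q.coeff i = D R₀ i := by
      intro i
      simp [q, Polynomial.coeff_monomial, Fin.val_inj]
    have hq : q ≠ 0 := fun h0 => hE₀.1 (funext fun i => by rw [← hcoeff, h0]; rfl)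
    have hdeg : q.natDegree ≤ j := by
      refine Polynomial.natDegree_sum_le_of_forall_le _ _ fun i _ => ?_
      exact (Polynomial.natDegree_monomial_le _).trans i.2.le
    refine le_trans ?_ ((Multiset.toFinset_card_le _).trans
      ((Polynomial.card_roots' q).trans hdeg))
    refine Finset.card_le_card_of_injOn (fun R => R t) ?_ ?_
    · intro R hR
      obtain ⟨hR₁, hR₂⟩ := Finset.mem_filter.mp hR
      have hDR : D R = D R₀ := hD _ _ fun i hi => congrFun hR₂ ⟨i, hi⟩
      have := (Finset.mem_filter.mp hR₁).2.2
      simp only [hDR] at this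
      refine Multiset.mem_toFinset.mpr ((Polynomial.mem_roots hq).mpr ?_)
      simpa [q, Polynomial.IsRoot, Polynomial.eval_finsetSum] using this
    · intro R hR R' hR' h
      funext i
      by_cases hi : i = t
      · rw [hi]; exact h
      · have := (Finset.mem_filter.mp hR).2.trans (Finset.mem_filter.mp hR').2.symm
        exact congrFun this ⟨i, hi⟩
  have h₁ := Finset.card_le_mul_card_image _ _ hfib
  have h₂ : ((Finset.univ.filter E).image f).card ≤ Fintype.card F ^ (m - 1) := by
    refine (Finset.card_le_univ _).trans ?_
    simp
  have h₃ : Fintype.card F ^ m = Fintype.card F ^ (m - 1) * Fintype.card F := by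
    rw [← pow_succ]
    congr 1
    have := t.2
    omega
  have hpos : 0 < Fintype.card F := Fintype.card_pos
  unfold prob
  simp only [Nat.card_eq_fintype_card, Fintype.card_subtype, Fintype.card_fun, Fintype.card_fin]
  rw [div_le_div_iff₀ (by positivity) (by positivity), h₃]
  norm_cast
  calc _ ≤ j * Fintype.card F ^ (m - 1) * Fintype.card F :=
        Nat.mul_le_mul_right _ (h₁.trans (Nat.mul_le_mul_left _ h₂))
    _ = _ := by ring

end Probability

/-! ### Symbolic values -/

/-- An execution of the protocol: a field, the input, the point, the coins and the prover's strategy. -/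
structure Env (N k m : ℕ) : Type (u + 1) where
  F : Type u
  [field : Field F]
  x : Label N → F
  z : Fin k → F
  R : Fin m → F
  σ : Strategy F

attribute [instance] Env.field

variable {N k m : ℕ}

/-- The execution that differs from `e` in the coins only. -/
abbrev Env.withCoins (e : Env.{u} N k m) (R : Fin m → e.F) : Env.{u} N k m := { e with R := R }

/-- A symbolic value: an element of the field in every execution.  Symbolic values form a commutative
ring, and a straight-line program computes the same ones over every field. -/
abbrev Val (N k m : ℕ) : Type (u + 1) := (e : Env.{u} N k m) → e.F

/-- The coin number `t`, and `0` if there is no such coin. -/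
def coin (t : ℕ) : Val.{u} N k m := fun e => if h : t < m then e.R ⟨t, h⟩ else 0

/-- The messages of the verifier that reveal the first `t` coins. -/
def hist (t : ℕ) (e : Env.{u} N k m) : List e.F := (List.range t).map fun j => coin j e

/-- The `n`-th message of the prover, sent when the first `t` coins have been revealed. -/
def msg (t n : ℕ) : Val.{u} N k m := fun e => e.σ (hist t e) n

theorem hist_succ (t : ℕ) (e : Env.{u} N k m) : hist (t + 1) e = hist t e ++ [coin t e] := by
  simp [hist, List.range_succ]

/-- `v` is determined by the first `t` coins, apart from the other data of the execution. -/
def Causal (t : ℕ) (v : Val.{u} N k m) : Prop :=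
  ∀ (e : Env.{u} N k m) (R : Fin m → e.F), (∀ j : Fin m, j.1 < t → R j = e.R j) →
    v (e.withCoins R) = v e

theorem causal_coin {j t : ℕ} (h : j < t) : Causal t (coin j : Val.{u} N k m) := by
  intro e R hR
  unfold coin
  split
  · exact hR _ h
  · rfl

theorem hist_withCoins {t : ℕ} (e : Env.{u} N k m) (R : Fin m → e.F)
    (hR : ∀ j : Fin m, j.1 < t → R j = e.R j) : hist t (e.withCoins R) = hist t e :=
  List.map_congr_left fun _ hj => causal_coin (List.mem_range.mp hj) e R hR

theorem causal_msg (t n : ℕ) : Causal t (msg t n : Val.{u} N k m) := fun e R hR => by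
  change e.σ (hist t (e.withCoins R)) n = _
  rw [hist_withCoins e R hR]
  rfl

/-! ### Programs that compute symbolic values -/

/-- The registers `ρ` hold the values in `A`, each at the same place in all executions. -/
def Stored (ρ : (e : Env.{u} N k m) → ℕ → e.F) (A : Set (Val.{u} N k m)) : Prop :=
  ∃ L, ∀ v ∈ A, ∃ r < L, ∀ e, ρ e r = v e

namespace Stored

variable {ρ : (e : Env.{u} N k m) → ℕ → e.F} {A B : Set (Val.{u} N k m)} {v : Val.{u} N k m}

theorem mono (h : Stored ρ A) (hBA : B ⊆ A) : Stored ρ B :=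
  h.imp fun _ hL v hv => hL v (hBA hv)

theorem get (h : Stored ρ A) (hv : v ∈ A) : ∃ r, ∀ e, ρ e r = v e :=
  let ⟨_, hL⟩ := h
  let ⟨r, _, hr⟩ := hL v hv
  ⟨r, hr⟩

/-- There is a free register.  It is chosen before the value to be written. -/
theorem write (h : Stored ρ A) : ∃ dst, ∀ v : Val.{u} N k m,
    Stored (fun e => Function.update (ρ e) dst (v e)) (insert v A) := by
  obtain ⟨L, hL⟩ := h
  refine ⟨L, fun v => ⟨L + 1, fun w hw => ?_⟩⟩
  rcases hw with rfl | hw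
  · exact ⟨L, by omega, fun e => by simp⟩
  · obtain ⟨r, hr, h⟩ := hL w hw
    exact ⟨r, by omega, fun e => by simp [hr.ne, h]⟩

theorem compute {c : ℕ} (h : SL A c B) : ∀ {ρ : (e : Env.{u} N k m) → ℕ → e.F}, Stored ρ A →
    ∃ p : List Arith, p.length = c ∧ Stored (fun e => p.foldl Arith.exec (ρ e)) B := by
  induction h with
  | nil => exact fun h => ⟨[], rfl, h⟩
  | const a _ ih =>
    intro ρ h
    obtain ⟨p, rfl, hp⟩ := ih h
    obtain ⟨dst, hd⟩ := hp.write
    refine ⟨p ++ [.const dst a], by simp, ?_⟩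
    convert hd (if a then 1 else 0) using 2 with e
    rw [List.foldl_append]
    cases a <;> rfl
  | add _ hu hv ih | sub _ hu hv ih | mul _ hu hv ih =>
    intro ρ h
    obtain ⟨p, rfl, hp⟩ := ih h
    obtain ⟨dst, hd⟩ := hp.write
    obtain ⟨r₁, h₁⟩ := hp.get hu
    obtain ⟨r₂, h₂⟩ := hp.get hv
    first
    | refine ⟨p ++ [.add dst r₁ r₂], by simp, ?_⟩
      convert hd _ using 2 with e
      rw [List.foldl_append, Pi.add_apply, ← h₁ e, ← h₂ e]
      rfl
    | refine ⟨p ++ [.sub dst r₁ r₂], by simp, ?_⟩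
      convert hd _ using 2 with e
      rw [List.foldl_append, Pi.sub_apply, ← h₁ e, ← h₂ e]
      rfl
    | refine ⟨p ++ [.mul dst r₁ r₂], by simp, ?_⟩
      convert hd _ using 2 with e
      rw [List.foldl_append, Pi.mul_apply, ← h₁ e, ← h₂ e]
      rfl

end Stored

/-- Some pre-processing program of length at most `c` computes the values in `A`. -/
def Pre (c : ℕ) (A : Set (Val.{u} N k m)) : Prop :=
  ∃ p : List (PreInstr m), p.length ≤ c ∧
    Stored (fun e => p.foldl (PreInstr.exec e.R) fun _ => 0) A

theorem Pre.nil : Pre 0 (∅ : Set (Val.{u} N k m)) := ⟨[], le_rfl, 0, by simp⟩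

theorem Pre.comp {c d : ℕ} {A B : Set (Val.{u} N k m)} (h : Pre c A) (h' : Comp A d B) :
    Pre (c + d) (A ∪ B) := by
  obtain ⟨p, hp, hs⟩ := h
  obtain ⟨d', hd', D, hD, hBD⟩ := h'
  obtain ⟨q, rfl, hq⟩ := Stored.compute hD hs
  refine ⟨p ++ q.map .arith, by simp; omega, ?_⟩
  refine Stored.mono (B := A ∪ B) ?_ (Set.union_subset hD.subset hBD)
  convert hq using 2 with e
  rw [List.foldl_append, List.foldl_map]
  rfl

theorem Pre.coins {c : ℕ} {A : Set (Val.{u} N k m)} (h : Pre c A) {l : ℕ} (t : Fin l → ℕ)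
    (ht : ∀ i, t i < m) : Pre (c + l) (A ∪ Set.range fun i => coin (t i)) := by
  induction l with
  | zero => simpa using h
  | succ l ih =>
    obtain ⟨p, hp, hs⟩ := ih (fun i => t i.castSucc) (fun i => ht _)
    obtain ⟨dst, hd⟩ := hs.write
    refine ⟨p ++ [.coin dst ⟨t (Fin.last l), ht _⟩], by simp; omega, ?_⟩
    refine Stored.mono (A := insert (coin (t (Fin.last l)))
      (A ∪ Set.range fun i : Fin l => coin (t i.castSucc))) ?_ ?_
    · convert hd (coin (t (Fin.last l))) using 2 with e
      rw [List.foldl_append, coin, dif_pos (ht _)]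
      rfl
    · rintro v (hv | ⟨i, rfl⟩)
      · exact .inr (.inl hv)
      · refine Fin.lastCases (.inl rfl) (fun i => .inr (.inr ⟨i, rfl⟩)) i

/-! ### Runs of the verifier and of the honest prover -/

/-- The instruction exchanges a field element with the prover. -/
def VInstr.isMessage : VInstr N k m → Bool
  | .send _ => true
  | .recv _ => true
  | _ => false

/-- There is an online program of length at most `c` with at most `cm` messages that, after the
pre-processing `p`, stores the values in `A`, reveals the first `t` coins and receives `n` messages, and
passes its checks exactly in the executions that satisfy `ok`. -/
def Online (p : List (PreInstr m)) (c cm : ℕ) (A : Set (Val.{u} N k m)) (t n : ℕ)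
    (ok : Env.{u} N k m → Prop) : Prop :=
  ∃ on : List (VInstr N k m), on.length ≤ c ∧ on.countP VInstr.isMessage ≤ cm ∧
    ∃ ρ, Stored ρ A ∧ ∀ e,
      (ok e → on.foldlM (VInstr.step e.z e.x e.R e.σ)
        ⟨p.foldl (PreInstr.exec e.R) fun _ => 0, [], 0⟩ = some ⟨ρ e, hist t e, n⟩) ∧
      (¬ ok e → on.foldlM (VInstr.step e.z e.x e.R e.σ)
        ⟨p.foldl (PreInstr.exec e.R) fun _ => 0, [], 0⟩ = none)

namespace Online

variable {p : List (PreInstr m)} {c cm t n : ℕ} {A B : Set (Val.{u} N k m)}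
  {ok : Env.{u} N k m → Prop}

theorem mono {c' cm' : ℕ} (h : Online p c cm A t n ok) (hc : c ≤ c') (hm : cm ≤ cm') (hBA : B ⊆ A) :
    Online p c' cm' B t n ok :=
  let ⟨on, h₁, h₂, ρ, h₃, h₄⟩ := h
  ⟨on, h₁.trans hc, h₂.trans hm, ρ, h₃.mono hBA, h₄⟩

theorem init (h : Stored (fun e : Env.{u} N k m => p.foldl (PreInstr.exec e.R) fun _ => 0) A) :
    Online p 0 0 A 0 0 fun _ => True :=
  ⟨[], le_rfl, le_rfl, _, h, fun _ => ⟨fun _ => rfl, fun h => absurd trivial h⟩⟩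

/-- Appending an instruction other than a check.  Which one is appended may depend on the register
allocation `ρ` reached so far. -/
theorem snoc {w t' n' : ℕ} (h : Online p c cm A t n ok)
    (H : ∀ ρ, Stored ρ A → ∃ (i : VInstr N k m) (ρ' : (e : Env.{u} N k m) → ℕ → e.F),
      (if i.isMessage then 1 else 0) ≤ w ∧ Stored ρ' B ∧
      ∀ e, VInstr.step e.z e.x e.R e.σ ⟨ρ e, hist t e, n⟩ i = some ⟨ρ' e, hist t' e, n'⟩) :
    Online p (c + 1) (cm + w) B t' n' ok := by
  obtain ⟨on, h₁, h₂, ρ, h₃, h₄⟩ := h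
  obtain ⟨i, ρ', hw, hB, hi⟩ := H ρ h₃
  refine ⟨on ++ [i], by simpa using h₁, ?_, ρ', hB, fun e => ⟨fun he => ?_, fun he => ?_⟩⟩
  · rw [List.countP_append, List.countP_singleton]
    exact add_le_add h₂ hw
  · rw [List.foldlM_append, (h₄ e).1 he]
    simpa using hi e
  · rw [List.foldlM_append, (h₄ e).2 he]
    rfl

theorem comp {d : ℕ} (h : Online p c cm A t n ok) (h' : Comp A d B) :
    Online p (c + d) cm (A ∪ B) t n ok := by
  obtain ⟨on, h₁, h₂, ρ, h₃, h₄⟩ := h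
  obtain ⟨d', hd', D, hD, hBD⟩ := h'
  obtain ⟨q, rfl, hq⟩ := Stored.compute hD h₃
  have hcount : (q.map (VInstr.arith (N := N) (k := k) (m := m))).countP VInstr.isMessage = 0 := by
    simp [List.countP_eq_zero, VInstr.isMessage]
  have hrun : ∀ (e : Env.{u} N k m) (q : List Arith) (st : VState e.F),
      (q.map VInstr.arith).foldlM (VInstr.step e.z e.x e.R e.σ) st =
        some { st with reg := q.foldl Arith.exec st.reg } := by
    intro e q
    induction q with
    | nil => exact fun _ => rfl
    | cons o q ih => exact fun st => ih _
  refine ⟨on ++ q.map .arith, by simp; omega, by rw [List.countP_append, hcount]; exact h₂, _,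
    hq.mono (Set.union_subset hD.subset hBD), fun e => ⟨fun he => ?_, fun he => ?_⟩⟩
  · rw [List.foldlM_append, (h₄ e).1 he]
    exact hrun e q _
  · rw [List.foldlM_append, (h₄ e).2 he]
    rfl

theorem coin (h : Online p c cm A t n ok) {j : ℕ} (hj : j < m) :
    Online p (c + 1) cm (insert (coin j) A) t n ok :=
  h.snoc (w := 0) fun _ hρ =>
    let ⟨dst, hd⟩ := hρ.write
    ⟨.coin dst ⟨j, hj⟩, _, le_rfl, hd (DataParallel.coin j), fun e => by
      simp [VInstr.step, DataParallel.coin, hj]⟩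

theorem input (h : Online p c cm A t n ok) (j : Label N) :
    Online p (c + 1) cm (insert (fun e => e.x j) A) t n ok :=
  h.snoc (w := 0) fun _ hρ =>
    let ⟨dst, hd⟩ := hρ.write
    ⟨.input dst j, _, le_rfl, hd fun e => e.x j, fun _ => rfl⟩

theorem point (h : Online p c cm A t n ok) (j : Fin k) :
    Online p (c + 1) cm (insert (fun e => e.z j) A) t n ok :=
  h.snoc (w := 0) fun _ hρ =>
    let ⟨dst, hd⟩ := hρ.write
    ⟨.point dst j, _, le_rfl, hd fun e => e.z j, fun _ => rfl⟩

theorem reveal (h : Online p c cm A t n ok) (ht : DataParallel.coin t ∈ A) :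
    Online p (c + 1) (cm + 1) A (t + 1) n ok :=
  h.snoc fun ρ hρ =>
    let ⟨r, hr⟩ := hρ.get ht
    ⟨.send r, ρ, le_rfl, hρ, fun e => by simp [VInstr.step, hist_succ, hr]⟩

theorem recv (h : Online p c cm A t n ok) :
    Online p (c + 1) (cm + 1) (insert (msg t n) A) t (n + 1) ok :=
  h.snoc fun _ hρ =>
    let ⟨dst, hd⟩ := hρ.write
    ⟨.recv dst, _, le_rfl, hd (msg t n), fun _ => rfl⟩

theorem recvs (h : Online p c cm A t n ok) : ∀ j : ℕ,
    Online p (c + j) (cm + j) (A ∪ Set.range fun i : Fin j => msg t (n + i)) t (n + j) ok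
  | 0 => h.mono le_rfl le_rfl (by simp)
  | j + 1 => by
    refine (h.recvs j).recv.mono (by omega) (by omega) ?_
    rintro v (hv | ⟨i, rfl⟩)
    · exact .inr (.inl hv)
    · refine Fin.lastCases (.inl rfl) (fun i => .inr (.inr ⟨i, rfl⟩)) i

theorem range {ι : Type} [Fintype ι] {d : ℕ} (h : Online p c cm A t n ok) (f : ι → Val.{u} N k m)
    (hf : ∀ (i : ι) (c : ℕ) (A : Set (Val.{u} N k m)), Online p c cm A t n ok →
      Online p (c + d) cm (insert (f i) A) t n ok) :
    Online p (c + Fintype.card ι * d) cm (A ∪ Set.range f) t n ok := by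
  classical
  suffices H : ∀ s : Finset ι, Online p (c + s.card * d) cm (A ∪ f '' s) t n ok by
    simpa using H Finset.univ
  intro s
  induction s using Finset.induction_on with
  | empty => simpa using h
  | insert a s ha ih =>
    refine (hf a _ _ ih).mono (le_of_eq ?_) le_rfl (subset_of_eq ?_)
    · rw [Finset.card_insert_of_notMem ha]; ring
    · rw [Finset.coe_insert, Set.image_insert_eq, Set.union_insert]

theorem check (h : Online p c cm A t n ok) {v w : Val.{u} N k m} (hv : v ∈ A) (hw : w ∈ A) :
    Online p (c + 1) cm A t n fun e => ok e ∧ v e = w e := by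
  obtain ⟨on, h₁, h₂, ρ, h₃, h₄⟩ := h
  obtain ⟨a, ha⟩ := h₃.get hv
  obtain ⟨b, hb⟩ := h₃.get hw
  refine ⟨on ++ [.check a b], by simpa using h₁, ?_, ρ, h₃, fun e => ⟨fun he => ?_, fun he => ?_⟩⟩
  · rw [List.countP_append]
    exact h₂
  · rw [List.foldlM_append, (h₄ e).1 he.1]
    simp [VInstr.step, ha, hb, he.2]
  · rw [List.foldlM_append]
    by_cases h : ok e
    · have : ¬ v e = w e := fun h' => he ⟨h, h'⟩
      rw [(h₄ e).1 h]
      simp [VInstr.step, ha, hb, this]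
    · rw [(h₄ e).2 h]
      rfl

/-- At the end of the online phase the verifier can put any stored value into her output register. -/
theorem output (h : Online p c cm A t n ok) {v : Val.{u} N k m} (hv : v ∈ A) :
    ∃ on : List (VInstr N k m), on.length ≤ c + 2 ∧
      (Verifier.mk m p on).communication ≤ cm ∧ ∀ e : Env.{u} N k m,
        (ok e → (Verifier.mk m p on).out e.z e.x e.R e.σ = some (v e)) ∧
        (¬ ok e → (Verifier.mk m p on).out e.z e.x e.R e.σ = none) := by
  obtain ⟨on, h₁, h₂, ρ, h₃, h₄⟩ := h.comp Comp.zero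
  obtain ⟨a, ha⟩ := h₃.get (.inl hv)
  obtain ⟨b, hb⟩ := h₃.get (.inr rfl)
  refine ⟨on ++ [.arith (.add 0 a b)], by simpa using h₁, ?_, fun e => ⟨fun he => ?_, fun he => ?_⟩⟩
  · refine le_trans (le_of_eq ?_) h₂
    unfold Verifier.communication
    rw [List.countP_append]
    refine (List.countP_congr fun i _ => ?_ : List.countP _ on = List.countP VInstr.isMessage on)
    cases i <;> rfl
  · rw [Verifier.out, List.foldlM_append, (h₄ e).1 he]
    simp [VInstr.step, Arith.exec, ha, hb]
  · rw [Verifier.out, List.foldlM_append, (h₄ e).2 he]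
    rfl

end Online

/-- When the first `t` coins have been revealed, the prover's program `P` has stored the values in `A`,
which do not depend on the other coins, and has sent the messages `msgs`. -/
def PRun (P : ProverProgram N k) (A : Set (Val.{u} N k m)) (t : ℕ) (msgs : List (Val.{u} N k m)) :
    Prop :=
  ∃ ρ, Stored ρ A ∧ (∀ r, Causal t fun e => ρ e r) ∧
    ∀ (e : Env.{u} N k m) (Q : ProverProgram N k) (h : List e.F),
      ProverProgram.run e.z e.x (P ++ Q) (fun _ => 0) (hist t e ++ h) =
        msgs.map (fun v => v e) ++ ProverProgram.run e.z e.x Q (ρ e) h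

/-- The prover follows the program `P` in the execution `e`, and any continuation of it later. -/
def Follows (P : ProverProgram N k) (e : Env.{u} N k m) : Prop :=
  ∃ Q : ProverProgram N k, e.σ = ProverProgram.strategy (P ++ Q : ProverProgram N k) e.z e.x

theorem Follows.of_append {P P' : ProverProgram N k} {e : Env.{u} N k m}
    (h : Follows (P ++ P' : ProverProgram N k) e) : Follows P e :=
  let ⟨Q, hQ⟩ := h
  ⟨P' ++ Q, by rw [hQ, List.append_assoc]⟩

namespace PRun

variable {P : ProverProgram N k} {t : ℕ} {A B : Set (Val.{u} N k m)} {msgs : List (Val.{u} N k m)}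

theorem mono (h : PRun P A t msgs) (hBA : B ⊆ A) : PRun P B t msgs :=
  let ⟨ρ, h₁, h₂⟩ := h
  ⟨ρ, h₁.mono hBA, h₂⟩

theorem causal (h : PRun P A t msgs) {v : Val.{u} N k m} (hv : v ∈ A) : Causal t v := by
  obtain ⟨ρ, h₁, h₂, -⟩ := h
  obtain ⟨r, hr⟩ := h₁.get hv
  have : v = fun e => ρ e r := funext fun e => (hr e).symm
  rw [this]
  exact h₂ r

/-- What the verifier receives from the honest prover is what his program sends. -/
theorem msg_eq (h : PRun P A t msgs) {e : Env.{u} N k m} (he : Follows P e) {i : ℕ}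
    (hi : i < msgs.length) : msg t i e = msgs[i] e := by
  obtain ⟨ρ, -, -, h₃⟩ := h
  obtain ⟨Q, hQ⟩ := he
  have := h₃ e Q []
  rw [List.append_nil] at this
  rw [msg, hQ, ProverProgram.strategy, this, List.getD_append _ _ _ _ (by simpa using hi)]
  simp [hi]

theorem init : PRun ([] : ProverProgram N k) (∅ : Set (Val.{u} N k m)) 0 [] :=
  ⟨fun _ _ => 0, ⟨0, by simp⟩, fun _ _ _ _ => rfl, fun _ _ _ => rfl⟩

theorem causal_update {ρ : (e : Env.{u} N k m) → ℕ → e.F} (h : ∀ r, Causal t fun e => ρ e r)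
    {v : Val.{u} N k m} (hv : Causal t v) (dst r : ℕ) :
    Causal t fun e => Function.update (ρ e) dst (v e) r := by
  intro e R hR
  by_cases hr : r = dst
  · subst hr
    simpa using hv e R hR
  · simpa [hr] using h r e R hR

theorem comp {d : ℕ} (h : PRun P A t msgs) (h' : Comp A d B) :
    ∃ P' : ProverProgram N k, P'.length ≤ d ∧ PRun (P ++ P') (A ∪ B) t msgs := by
  obtain ⟨ρ, h₁, h₂, h₃⟩ := h
  obtain ⟨d', hd', D, hD, hBD⟩ := h'
  obtain ⟨q, rfl, hq⟩ := Stored.compute hD h₁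
  refine ⟨q.map .arith, by simpa using hd', _, hq.mono (Set.union_subset hD.subset hBD), ?_, ?_⟩
  · clear h₁ h₃ hq hd' hD
    induction q generalizing ρ with
    | nil => exact h₂
    | cons o q ih =>
      refine ih (fun e => o.exec (ρ e)) ?_
      cases o with
      | const dst c =>
        exact fun r => causal_update h₂ (v := fun e => if c then 1 else 0) (fun _ _ _ => rfl) dst r
      | add dst a b =>
        exact fun r => causal_update h₂ (v := fun e => ρ e a + ρ e b)
          (fun e R hR => congrArg₂ (· + ·) (h₂ a e R hR) (h₂ b e R hR)) dst r
      | sub dst a b =>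
        exact fun r => causal_update h₂ (v := fun e => ρ e a - ρ e b)
          (fun e R hR => congrArg₂ (· - ·) (h₂ a e R hR) (h₂ b e R hR)) dst r
      | mul dst a b =>
        exact fun r => causal_update h₂ (v := fun e => ρ e a * ρ e b)
          (fun e R hR => congrArg₂ (· * ·) (h₂ a e R hR) (h₂ b e R hR)) dst r
  · intro e Q h
    rw [List.append_assoc, h₃]
    congr 1
    clear hq hd' hD
    generalize ρ e = ρ₀
    induction q generalizing ρ₀ with
    | nil => rfl
    | cons o q ih => exact ih _

theorem input (h : PRun P A t msgs) (j : Label N) :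
    ∃ i : PInstr N k, PRun (P ++ [i]) (insert (fun e => e.x j) A) t msgs := by
  obtain ⟨ρ, h₁, h₂, h₃⟩ := h
  obtain ⟨dst, hd⟩ := h₁.write
  refine ⟨.input dst j, _, hd _, causal_update h₂ (fun _ _ _ => rfl) dst, fun e Q h => ?_⟩
  rw [List.append_assoc, h₃]
  rfl

theorem point (h : PRun P A t msgs) (j : Fin k) :
    ∃ i : PInstr N k, PRun (P ++ [i]) (insert (fun e => e.z j) A) t msgs := by
  obtain ⟨ρ, h₁, h₂, h₃⟩ := h
  obtain ⟨dst, hd⟩ := h₁.write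
  refine ⟨.point dst j, _, hd _, causal_update h₂ (fun _ _ _ => rfl) dst, fun e Q h => ?_⟩
  rw [List.append_assoc, h₃]
  rfl

theorem recv (h : PRun P A t msgs) :
    ∃ i : PInstr N k, PRun (P ++ [i]) (insert (coin t) A) (t + 1) msgs := by
  obtain ⟨ρ, h₁, h₂, h₃⟩ := h
  obtain ⟨dst, hd⟩ := h₁.write
  refine ⟨.recv dst, _, hd _, causal_update (fun r e R hR => h₂ r e R fun j hj => hR j (by omega))
    (causal_coin t.lt_succ_self) dst, fun e Q h => ?_⟩
  rw [List.append_assoc, hist_succ, List.append_assoc, h₃]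
  rfl

theorem send (h : PRun P A t msgs) {v : Val.{u} N k m} (hv : v ∈ A) :
    ∃ i : PInstr N k, PRun (P ++ [i]) A t (msgs ++ [v]) := by
  obtain ⟨ρ, h₁, h₂, h₃⟩ := h
  obtain ⟨r, hr⟩ := h₁.get hv
  refine ⟨.send r, ρ, h₁, h₂, fun e Q h => ?_⟩
  rw [List.append_assoc, h₃, List.map_append, List.append_assoc]
  simp [ProverProgram.run, hr e]

theorem sends (h : PRun P A t msgs) (l : List (Val.{u} N k m)) (hl : ∀ v ∈ l, v ∈ A) :
    ∃ P' : ProverProgram N k, P'.length = l.length ∧ PRun (P ++ P') A t (msgs ++ l) := by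
  induction l generalizing P msgs with
  | nil => exact ⟨[], rfl, by simpa using h⟩
  | cons v l ih =>
    obtain ⟨i, h'⟩ := h.send (hl v (by simp))
    obtain ⟨P', hP', h''⟩ := ih h' fun w hw => hl w (by simp [hw])
    rw [List.append_assoc, List.append_assoc] at h''
    exact ⟨[i] ++ P', by simp [hP'], h''⟩

theorem range {ι : Type} [Fintype ι] (h : PRun P A t msgs) (f : ι → Val.{u} N k m)
    (hf : ∀ (i : ι) (P : ProverProgram N k) (A : Set (Val.{u} N k m)), PRun P A t msgs →
      ∃ o : PInstr N k, PRun (P ++ [o]) (insert (f i) A) t msgs) :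
    ∃ P' : ProverProgram N k, P'.length = Fintype.card ι ∧
      PRun (P ++ P') (A ∪ Set.range f) t msgs := by
  classical
  suffices H : ∀ s : Finset ι, ∃ P' : ProverProgram N k, P'.length = s.card ∧
      PRun (P ++ P') (A ∪ f '' s) t msgs by
    simpa using H Finset.univ
  intro s
  induction s using Finset.induction_on with
  | empty => exact ⟨[], rfl, by simpa using h⟩
  | insert a s ha ih =>
    obtain ⟨P', hP', h'⟩ := ih
    obtain ⟨o, ho⟩ := hf a _ _ h'
    refine ⟨P' ++ [o], by simp [hP', ha], ?_⟩
    rw [Finset.coe_insert, Set.image_insert_eq, Set.union_insert, ← List.append_assoc]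
    exact ho

end PRun

/-! ### The invariant of the protocol -/

/-- The two parties have reached a point of the protocol where the value `τ₀` claimed in the first
message of the prover has been reduced to a claim about `τ`.  They have used at most `cV` and `cP` steps
and `cm` messages, the verifier has stored the values in `AV` and the prover those in `AP`, and the first
`t` coins have been revealed.  The honest prover passes all checks, and his claims are true.  For every
prover, the event that all checks have been passed, the first claim is false, and yet the current claim
`c` is true has probability at most `err / |F|`. -/
def Inv (p : List (PreInstr m)) (τ₀ : Val.{u} N k m) (cV cm cP : ℕ) (AV AP : Set (Val.{u} N k m)) (t : ℕ)
    (τ : Val.{u} N k m) (err : ℕ) : Prop :=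
  ∃ (P : ProverProgram N k) (ok : Env.{u} N k m → Prop) (msgs : List (Val.{u} N k m))
    (c : Val.{u} N k m), P.length ≤ cP ∧
    Online p cV cm (insert c (insert (msg 0 0) AV)) t msgs.length ok ∧ PRun P AP t msgs ∧
    (∀ e : Env.{u} N k m, Follows P e → ok e ∧ msg 0 0 e = τ₀ e ∧ c e = τ e) ∧
    ∀ (e : Env.{u} N k m) [Finite e.F], prob (fun R : Fin m → e.F => ok (e.withCoins R) ∧
      msg 0 0 (e.withCoins R) ≠ τ₀ (e.withCoins R) ∧ c (e.withCoins R) = τ (e.withCoins R)) ≤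
        (err : ℝ) / Nat.card e.F

namespace Inv

variable {p : List (PreInstr m)} {τ₀ τ : Val.{u} N k m} {cV cm cP t err : ℕ}
  {AV AP BV BP : Set (Val.{u} N k m)}

theorem mono {cV' cm' cP' err' : ℕ} (h : Inv p τ₀ cV cm cP AV AP t τ err) (hV : cV ≤ cV')
    (hm : cm ≤ cm') (hP : cP ≤ cP') (he : err ≤ err') (hBV : BV ⊆ AV) (hBP : BP ⊆ AP) :
    Inv p τ₀ cV' cm' cP' BV BP t τ err' := by
  obtain ⟨P, ok, msgs, c, h₁, h₂, h₃, h₄, h₅⟩ := h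
  refine ⟨P, ok, msgs, c, h₁.trans hP,
    h₂.mono hV hm (Set.insert_subset_insert (Set.insert_subset_insert hBV)), h₃.mono hBP, h₄, ?_⟩
  intro e _
  refine (h₅ e).trans ?_
  gcongr

theorem compV {d : ℕ} (h : Inv p τ₀ cV cm cP AV AP t τ err) (h' : Comp AV d BV) :
    Inv p τ₀ (cV + d) cm cP (AV ∪ BV) AP t τ err := by
  obtain ⟨P, ok, msgs, c, h₁, h₂, h₃⟩ := h
  refine ⟨P, ok, msgs, c, h₁, (h₂.comp (h'.mono ?_ subset_rfl)).mono le_rfl le_rfl ?_, h₃⟩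
  · exact (Set.subset_insert _ _).trans (Set.subset_insert _ _)
  · rw [Set.insert_union, Set.insert_union]

theorem compP {d : ℕ} (h : Inv p τ₀ cV cm cP AV AP t τ err) (h' : Comp AP d BP) :
    Inv p τ₀ cV cm (cP + d) AV (AP ∪ BP) t τ err := by
  obtain ⟨P, ok, msgs, c, h₁, h₂, h₃, h₄, h₅⟩ := h
  obtain ⟨P', hP', h₃'⟩ := h₃.comp h'
  exact ⟨P ++ P', ok, msgs, c, by simp; omega, h₂, h₃', fun e he => h₄ e he.of_append, h₅⟩

/-- The start of the protocol: the prover sends `τ₀`, and the verifier reads the point and the input. -/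
theorem init {d : ℕ} (hp : Stored (fun e : Env.{u} N k m => p.foldl (PreInstr.exec e.R) fun _ => 0) AV)
    (hd : Comp ((Set.range fun (i : Fin k) (e : Env.{u} N k m) => e.z i) ∪
      Set.range fun (i : Label N) (e : Env.{u} N k m) => e.x i) d AP) (hτ : τ₀ ∈ AP) :
    Inv p τ₀ (1 + k + 2 ^ N) 1 (k + 2 ^ N + d + 1)
      (AV ∪ ((Set.range fun (i : Fin k) (e : Env.{u} N k m) => e.z i) ∪
        Set.range fun (i : Label N) (e : Env.{u} N k m) => e.x i))
      (((Set.range fun (i : Fin k) (e : Env.{u} N k m) => e.z i) ∪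
        Set.range fun (i : Label N) (e : Env.{u} N k m) => e.x i) ∪ AP) 0 τ₀ 0 := by
  have hV := (((Online.init hp).recv).range (d := 1) (fun (i : Fin k) (e : Env.{u} N k m) => e.z i)
    fun i _ _ h => h.point i).range (d := 1) (fun (i : Label N) (e : Env.{u} N k m) => e.x i)
    fun i _ _ h => h.input i
  obtain ⟨P₁, hP₁, h₁⟩ := (PRun.init (N := N) (m := m)).range
    (fun (i : Fin k) (e : Env.{u} N k m) => e.z i) fun i _ _ h => h.point i
  obtain ⟨P₂, hP₂, h₂⟩ := h₁.range (fun (i : Label N) (e : Env.{u} N k m) => e.x i)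
    fun i _ _ h => h.input i
  rw [Set.empty_union] at h₂
  obtain ⟨P₃, hP₃, h₃⟩ := h₂.comp hd
  obtain ⟨i, h₄⟩ := h₃.send (.inr hτ)
  refine ⟨_, _, _, msg 0 0, ?_, hV.mono ?_ le_rfl ?_, h₄, fun e he => ?_, fun e _ => ?_⟩
  · simp [hP₁, hP₂]
    omega
  · simp
  · rw [Set.insert_eq_of_mem (Set.mem_insert _ _), Set.insert_union, Set.insert_union,
      Set.union_assoc]
  · have := h₄.msg_eq he (i := 0) (by simp)
    exact ⟨trivial, this, this⟩
  · rw [prob_of_forall_not fun R h => h.2.1 h.2.2]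
    simp

/-- One exchange of the protocol.  The prover sends the values `g i`, the verifier checks that the claim
about `τ` follows from what she has received and reveals the coin `t`, and the new claim is about the value
at this coin of the polynomial with coefficients `g i`.  If the claim was false and the check is passed,
then the polynomial sent is not the right one, and the two polynomials agree at the coin with probability
at most `j / |F|`. -/
theorem exchange {j d : ℕ} (h : Inv p τ₀ cV cm cP AV AP t τ err) (ht : t < m)
    (g : Fin j → Val.{u} N k m) (hg : Set.range g ⊆ AP)
    (chk : (e : Env.{u} N k m) → (Fin j → e.F) → e.F) (hτ : ∀ e, τ e = chk e fun i => g i e)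
    (hchk : ∀ μ : Fin j → Val.{u} N k m,
      Comp (AV ∪ Set.range μ) d {fun e => chk e fun i => μ i e}) :
    Inv p τ₀ (cV + (d + 3 * j + 4)) (cm + (j + 1)) (cP + (j + 1)) (insert (coin t) AV)
      (insert (coin t) AP) (t + 1) (∑ i, g i * coin t ^ (i : ℕ)) (err + j) := by
  obtain ⟨P, ok, msgs, c, h₁, h₂, h₃, h₄, h₅⟩ := h
  obtain ⟨P', hP', h₃'⟩ := h₃.sends (List.ofFn g) (by
    intro v hv
    obtain ⟨i, rfl⟩ := List.mem_ofFn.mp hv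
    exact hg ⟨i, rfl⟩)
  obtain ⟨o, h₃''⟩ := h₃'.recv
  set μ : Fin j → Val.{u} N k m := fun i => msg t (msgs.length + i)
  have hV := h₂.recvs j
  have hV₁ := (hV.comp (B := {fun e => chk e fun i => μ i e})
    ((hchk μ).mono (Set.union_subset_union_left _ ?_) subset_rfl)).check
      (v := c) (w := fun e => chk e fun i => μ i e) (by simp) (by simp)
  swap
  · exact (Set.subset_insert _ _).trans (Set.subset_insert _ _)
  have hV₂ := ((hV₁.coin ht).reveal (by simp)).comp (Comp.horner (r := coin t) (by simp) μ ?_)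
  swap
  · intro v hv
    exact .inr (.inl (.inr hv))
  have hsum : ∀ (e : Env.{u} N k m) (g : Fin j → Val.{u} N k m),
      (∑ i, g i * coin t ^ (i : ℕ) : Val.{u} N k m) e = ∑ i, g i e * coin t e ^ (i : ℕ) := by
    intro e g
    rw [Finset.sum_apply]
    rfl
  refine ⟨P ++ P' ++ [o], fun e => ok e ∧ c e = chk e fun i => μ i e, msgs ++ List.ofFn g, ∑ i, μ i * coin t ^ (i : ℕ), ?_, ?_, h₃'', ?_, ?_⟩
  · simp [hP']
    omega
  · rw [List.length_append, List.length_ofFn]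
    refine hV₂.mono (by omega) (by omega) ?_
    rintro v (rfl | rfl | rfl | hv)
    · simp
    · simp
    · simp
    · simp [hv]
  · intro e he
    have he' := he.of_append
    obtain ⟨h₆, h₇, h₈⟩ := h₄ e he'.of_append
    have hμg : ∀ i, μ i e = g i e := by
      intro i
      have := h₃'.msg_eq he' (i := msgs.length + i) (by simp)
      exact this.trans (by simp)
    refine ⟨⟨h₆, ?_⟩, h₇, ?_⟩
    · simp only [h₈, hτ, hμg]
    · simp only [hsum, hμg]
  · intro e _
    set D : (Fin m → e.F) → Fin j → e.F := fun R i => μ i (e.withCoins R) - g i (e.withCoins R)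
    have hD : ∀ R R', (∀ i, i ≠ (⟨t, ht⟩ : Fin m) → R i = R' i) → D R = D R' := by
      intro R R' hR
      have hR' : ∀ i : Fin m, i.1 < t → R i = R' i := fun i hi =>
        hR i fun h => by rw [h] at hi; exact lt_irrefl _ hi
      exact funext fun i => congrArg₂ (· - ·) (causal_msg t _ (e.withCoins R') R hR')
        (h₃.causal (hg ⟨i, rfl⟩) (e.withCoins R') R hR')
    refine (prob_le_of_imp fun R hR => ?_).trans ((prob_or_le _ _).trans
      (add_le_add (h₅ e) (prob_root_le ⟨t, ht⟩ D hD))) |>.trans (le_of_eq ?_)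
    · obtain ⟨⟨hok, hc⟩, hne, heq⟩ := hR
      by_cases hcl : c (e.withCoins R) = τ (e.withCoins R)
      · exact .inl ⟨hok, hne, hcl⟩
      · refine .inr ⟨fun h0 => hcl ?_, ?_⟩
        · have : ∀ i, μ i (e.withCoins R) = g i (e.withCoins R) := fun i =>
            sub_eq_zero.mp (congrFun h0 i)
          rw [hc, hτ]
          simp only [this]
        · rw [hsum, hsum, ← sub_eq_zero, ← Finset.sum_sub_distrib] at heq
          refine Eq.trans (Finset.sum_congr rfl fun i _ => ?_) heq
          rw [← sub_mul, coin, dif_pos ht]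
    · push_cast
      ring

/-- The end of the protocol: the verifier computes `τ` herself. -/
theorem finish {d : ℕ} (f : (F : Type u) → [Field F] → (Fin k → F) → (Label N → F) → F)
    (h : Inv p (fun e => f e.F e.z e.x) cV cm cP AV AP t τ err) (hτ : Comp AV d {τ}) :
    ∃ (V : Verifier N k) (P : ProverProgram N k), V.preTime = p.length ∧
      V.onlineTime ≤ cV + d + 3 ∧ P.time ≤ cP ∧ V.communication ≤ cm ∧
      ∀ (F : Type u) [Field F] [Finite F], 3 * err ≤ Nat.card F → ∀ z : Fin k → F,
        IsValidProtocol (P.strategy z) V z (f F z) := by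
  obtain ⟨P, ok, msgs, c, h₁, h₂, h₃, h₄, h₅⟩ := h.compV hτ
  obtain ⟨on, h₆, h₇, h₈⟩ := (h₂.check (v := c) (w := τ) (by simp) (by simp)).output
    (v := msg 0 0) (by simp)
  refine ⟨⟨m, p, on⟩, P, rfl, by simpa [Verifier.onlineTime] using h₆, h₁, h₇, fun F _ _ hF z => ?_⟩
  have hP : IsValidProver ⟨m, p, on⟩ z (f F z) (P.strategy z) := by
    intro x
    refine prob_of_forall fun R => ?_
    let e : Env.{u} N k m := ⟨F, x, z, R, P.strategy z x⟩
    obtain ⟨h, h', h''⟩ := h₄ e ⟨[], by rw [List.append_nil]⟩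
    exact ((h₈ e).1 ⟨h, h''⟩).trans (congrArg some h')
  refine ⟨⟨⟨_, hP⟩, fun P' x => ?_⟩, hP⟩
  let e : Env.{u} N k m := ⟨F, x, z, fun _ => 0, P' x⟩
  have hpos : (0 : ℝ) < Nat.card F := by exact_mod_cast Nat.card_pos
  refine (prob_le_of_imp fun R hR => ?_).trans ((h₅ e).trans ?_)
  · by_cases hok : ok (e.withCoins R) ∧ c (e.withCoins R) = τ (e.withCoins R)
    · refine ⟨hok.1, fun h => hR.1 ?_, hok.2⟩
      exact ((h₈ (e.withCoins R)).1 hok).trans (congrArg some h)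
    · exact absurd ((h₈ (e.withCoins R)).2 hok) hR.2
  · rw [div_le_div_iff₀ hpos (by norm_num)]
    have : ((3 * err : ℕ) : ℝ) ≤ Nat.card F := by exact_mod_cast hF
    push_cast at this
    linarith

end Inv

/-! ### The sum-check protocol for a gate formula -/

section Gate

variable {P : Type*} [CommRing P]

/-- The gate formula: `e` times `l * r` if `m = 1`, and `e` times `l + r` if `m = 0`. -/
def phi (e m l r : P) : P := e * (m * (l * r - (l + r)) + (l + r))

theorem phi_zero_zero (e l : P) : phi e 0 l 0 = e * l := by
  simp [phi]

/-- The coefficients of `phi (e + X e') (m + X m') (l + X l') (r + X r')` as a polynomial in `X`. -/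
def coeffs (e e' m m' l l' r r' : P) : Fin 5 → P :=
  ![e * (m * (l * r - (l + r)) + (l + r)),
    e * (m * (l * r' + l' * r - (l' + r')) + m' * (l * r - (l + r)) + (l' + r')) +
      e' * (m * (l * r - (l + r)) + (l + r)),
    e * (m * (l' * r') + m' * (l * r' + l' * r - (l' + r'))) +
      e' * (m * (l * r' + l' * r - (l' + r')) + m' * (l * r - (l + r)) + (l' + r')),
    e * (m' * (l' * r')) + e' * (m * (l' * r') + m' * (l * r' + l' * r - (l' + r'))),
    e' * (m' * (l' * r'))]

theorem sum_coeffs (e e' m m' l l' r r' x : P) :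
    ∑ i, coeffs e e' m m' l l' r r' i * x ^ (i : ℕ) =
      phi (e + x * e') (m + x * m') (l + x * l') (r + x * r') := by
  simp only [coeffs, phi, Fin.sum_univ_five]
  simp
  ring

theorem Comp.coeffs {A : Set P} {e e' m m' l l' r r' : P} (he : Comp A 0 {e}) (he' : Comp A 1 {e'})
    (hm : Comp A 0 {m}) (hm' : Comp A 1 {m'}) (hl : Comp A 0 {l}) (hl' : Comp A 1 {l'})
    (hr : Comp A 0 {r}) (hr' : Comp A 1 {r'}) (i : Fin 5) :
    Comp A 40 {coeffs e e' m m' l l' r r' i} := by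
  have a₀ := (hl.mul hr).sub (hl.add hr)
  have a₁ := ((hl.mul hr').add (hl'.mul hr)).sub (hl'.add hr')
  have a₂ := hl'.mul hr'
  have b₀ := (hm.mul a₀).add (hl.add hr)
  have b₁ := ((hm.mul a₁).add (hm'.mul a₀)).add (hl'.add hr')
  have b₂ := (hm.mul a₂).add (hm'.mul a₁)
  have b₃ := hm'.mul a₂
  fin_cases i
  · exact (he.mul b₀).le (by norm_num)
  · exact ((he.mul b₁).add (he'.mul b₀)).le (by norm_num)
  · exact ((he.mul b₂).add (he'.mul b₁)).le (by norm_num)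
  · exact ((he.mul b₃).add (he'.mul b₂)).le (by norm_num)
  · exact (he'.mul b₃).le (by norm_num)

/-- The coefficients of the polynomial that the prover sends in one round of the sum-check protocol, as a
sum over the assignments `p` to the other variables. -/
def roundCoeffs {k : ℕ} (E M L R : Label (k + 1) → P) (p : Label k) : Fin 5 → P :=
  coeffs (E (Fin.cons false p)) (E (Fin.cons true p) - E (Fin.cons false p))
    (M (Fin.cons false p)) (M (Fin.cons true p) - M (Fin.cons false p))
    (L (Fin.cons false p)) (L (Fin.cons true p) - L (Fin.cons false p))
    (R (Fin.cons false p)) (R (Fin.cons true p) - R (Fin.cons false p))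

theorem sum_roundCoeffs {k : ℕ} (E M L R : Label (k + 1) → P) (x : P) :
    ∑ i, (∑ p, roundCoeffs E M L R p i) * x ^ (i : ℕ) =
      ∑ p, phi (bind E x p) (bind M x p) (bind L x p) (bind R x p) := by
  simp only [Finset.sum_mul]
  rw [Finset.sum_comm]
  exact Finset.sum_congr rfl fun p _ => sum_coeffs ..

theorem sum_phi_succ {k : ℕ} (E M L R : Label (k + 1) → P) :
    ∑ p, phi (E p) (M p) (L p) (R p) =
      (∑ p, roundCoeffs E M L R p 0) + ∑ i, ∑ p, roundCoeffs E M L R p i := by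
  have h := sum_roundCoeffs E M L R 1
  simp only [one_pow, mul_one] at h
  rw [h, ← Finset.sum_add_distrib, sum_label_succ]
  refine Finset.sum_congr rfl fun p _ => congrArg₂ (· + ·) rfl ?_
  simp [bind]

end Gate

/-- The coins with numbers `t, …, t + l - 1`. -/
def coinsFrom (t l : ℕ) : Fin l → Val.{u} N k m := fun i => coin (t + i)

theorem tail_coinsFrom (t l : ℕ) :
    Fin.tail (coinsFrom t (l + 1) : Fin (l + 1) → Val.{u} N k m) = coinsFrom (t + 1) l := by
  funext i
  simp only [Fin.tail, coinsFrom, Fin.val_succ]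
  congr 1
  ring

theorem coinsFrom_add (t s b : ℕ) : (coinsFrom t (s + b) : Fin (s + b) → Val.{u} N k m) =
    Fin.append (coinsFrom t s) (coinsFrom (t + s) b) := by
  funext i
  refine Fin.addCases (fun i => ?_) (fun i => ?_) i
  · simp [coinsFrom]
  · simp [coinsFrom, add_assoc]

theorem range_append {α : Type*} {s b : ℕ} (f : Fin s → α) (g : Fin b → α) :
    Set.range (Fin.append f g) = Set.range f ∪ Set.range g := by
  ext v
  constructor
  · rintro ⟨i, rfl⟩
    refine Fin.addCases (fun i => ?_) (fun i => ?_) i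
    · exact .inl ⟨i, by simp⟩
    · exact .inr ⟨i, by simp⟩
  · rintro (⟨i, rfl⟩ | ⟨i, rfl⟩)
    · exact ⟨Fin.castAdd _ i, by simp⟩
    · exact ⟨Fin.natAdd _ i, by simp⟩

theorem range_coinsFrom_succ (t l : ℕ) :
    Set.range (coinsFrom t (l + 1) : Fin (l + 1) → Val.{u} N k m) =
      insert (coin t) (Set.range (coinsFrom (t + 1) l)) := by
  rw [← tail_coinsFrom]
  ext v
  constructor
  · rintro ⟨i, rfl⟩
    exact Fin.cases (.inl rfl) (fun i => .inr ⟨i, rfl⟩) i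
  · rintro (rfl | ⟨i, rfl⟩)
    · exact ⟨0, rfl⟩
    · exact ⟨i.succ, rfl⟩

/-- The sum-check protocol.  The prover binds one variable after the other in all four tables, so that the
costs of the rounds form a geometric series. -/
theorem Inv.sumcheck {p : List (PreInstr m)} {τ₀ : Val.{u} N k m} {l : ℕ} :
    ∀ {cV cm cP t err : ℕ} {AV AP : Set (Val.{u} N k m)} {E M L R : Label l → Val.{u} N k m},
      Inv p τ₀ cV cm cP AV AP t (∑ p, phi (E p) (M p) (L p) (R p)) err →
      Set.range E ⊆ AP → Set.range M ⊆ AP → Set.range L ⊆ AP → Set.range R ⊆ AP → t + l ≤ m →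
      Inv p τ₀ (cV + 26 * l) (cm + 6 * l) (cP + 230 * 2 ^ l) (AV ∪ Set.range (coinsFrom t l))
        (AP ∪ Set.range (coinsFrom t l) ∪ {extend L (coinsFrom t l), extend R (coinsFrom t l)}) (t + l)
        (phi (extend E (coinsFrom t l)) (extend M (coinsFrom t l)) (extend L (coinsFrom t l))
          (extend R (coinsFrom t l))) (err + 5 * l) := by
  induction l with
  | zero =>
    intro cV cm cP t err AV AP E M L R h hE hM hL hR ht
    have hc : Set.range (coinsFrom t 0 : Fin 0 → Val.{u} N k m) = ∅ := Set.range_eq_empty _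
    simp only [extend_zero_vars, hc, Set.union_empty]
    rw [Fintype.sum_subsingleton _ (default : Label 0)] at h
    refine h.mono (by omega) (by omega) (by omega) (by omega) subset_rfl ?_
    rintro v (hv | rfl | rfl)
    · exact hv
    · exact hL ⟨_, rfl⟩
    · exact hR ⟨_, rfl⟩
  | succ l ih =>
    intro cV cm cP t err AV AP E M L R h hE hM hL hR ht
    have hcoeff : Comp AP (5 * (2 ^ l * 41 + 1))
        (Set.range fun (i : Fin 5) => ∑ p, roundCoeffs E M L R p i) := by
      have := Comp.range (A := AP) (fun (i : Fin 5) => ∑ p, roundCoeffs E M L R p i) fun i =>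
        Comp.sum Finset.univ _ fun p _ => Comp.coeffs
          (.var (hE ⟨_, rfl⟩)) (.sub (.var (hE ⟨_, rfl⟩)) (.var (hE ⟨_, rfl⟩)))
          (.var (hM ⟨_, rfl⟩)) (.sub (.var (hM ⟨_, rfl⟩)) (.var (hM ⟨_, rfl⟩)))
          (.var (hL ⟨_, rfl⟩)) (.sub (.var (hL ⟨_, rfl⟩)) (.var (hL ⟨_, rfl⟩)))
          (.var (hR ⟨_, rfl⟩)) (.sub (.var (hR ⟨_, rfl⟩)) (.var (hR ⟨_, rfl⟩))) i
      simpa using this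
    have h₁ := (h.compP hcoeff).exchange (d := 7) (by omega) _ Set.subset_union_right
      (fun _ μ => μ 0 + ∑ i, μ i) (fun e => ?_) fun μ => ?_
    rotate_left
    · exact (congrFun (sum_phi_succ E M L R) e).trans (by simp only [Pi.add_apply, Finset.sum_apply])
    · have h0 : Comp (AV ∪ Set.range μ) 7 {μ 0 + ∑ i, μ i} :=
        (Comp.add (.var (.inr ⟨0, rfl⟩)) (Comp.sum (c := 0) Finset.univ μ fun i _ =>
          .var (.inr ⟨i, rfl⟩))).le (by simp)
      have h0' : (μ 0 + ∑ i, μ i) = fun e => μ 0 e + ∑ i, μ i e := by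
        funext e
        rw [Pi.add_apply, Finset.sum_apply]
      rwa [h0'] at h0
    rw [sum_roundCoeffs] at h₁
    have hmem : AP ⊆ insert (coin t)
        (AP ∪ Set.range fun (i : Fin 5) => ∑ p, roundCoeffs E M L R p i) :=
      Set.subset_union_left.trans (Set.subset_insert _ _)
    have h₂ := (((h₁.compP (Comp.bind (r := coin t) (hE.trans hmem) (by simp))).compP
      (Comp.bind (r := coin t) (hM.trans (hmem.trans Set.subset_union_left)) (by simp))).compP
      (Comp.bind (r := coin t) (hL.trans ((hmem.trans Set.subset_union_left).trans
        Set.subset_union_left)) (by simp))).compP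
      (Comp.bind (r := coin t) (hR.trans (((hmem.trans Set.subset_union_left).trans
        Set.subset_union_left).trans Set.subset_union_left)) (by simp))
    have h₃ := ih h₂ (fun v hv => by simp only [Set.mem_union]; tauto)
      (fun v hv => by simp only [Set.mem_union]; tauto)
      (fun v hv => by simp only [Set.mem_union]; tauto)
      (fun v hv => by simp only [Set.mem_union]; tauto) (by omega)
    have key : ∀ T : Label (l + 1) → Val.{u} N k m,
        extend (bind T (coin t)) (coinsFrom (t + 1) l) = extend T (coinsFrom t (l + 1)) := by
      intro T
      rw [← extend_bind, tail_coinsFrom]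
      rfl
    simp only [key] at h₃
    rw [show t + (l + 1) = t + 1 + l by omega, range_coinsFrom_succ]
    refine h₃.mono (by omega) (by omega) ?_ (by omega) ?_ ?_
    · have := Nat.one_le_two_pow (n := l)
      rw [pow_succ]
      omega
    · intro v hv
      simp only [Set.mem_union, Set.mem_insert_iff] at hv ⊢
      tauto
    · intro v hv
      simp only [Set.mem_union, Set.mem_insert_iff, Set.mem_singleton_iff] at hv ⊢
      tauto

/-! ### Circuits over symbolic values -/

section RingEval

variable {P : Type*} [CommRing P]

/-- `Circuit.eval` over a commutative ring. -/
def Circuit.ringEval {n : ℕ} : {s : ℕ} → Circuit n s → (Label n → P) → Label s → P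
  | _, .input, x => x
  | _, .layer mul in₁ in₂ C, x => fun p =>
      if mul p then C.ringEval x (in₁ p) * C.ringEval x (in₂ p)
      else C.ringEval x (in₁ p) + C.ringEval x (in₂ p)

/-- The values of all gates of the circuit. -/
def Circuit.gateValues {n : ℕ} : {s : ℕ} → Circuit n s → (Label n → P) → Set P
  | _, .input, x => Set.range x
  | _, .layer mul in₁ in₂ C, x =>
      Set.range ((Circuit.layer mul in₁ in₂ C).ringEval x) ∪ C.gateValues x

theorem Circuit.range_ringEval_subset {n s : ℕ} (C : Circuit n s) (x : Label n → P) :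
    Set.range (C.ringEval x) ⊆ C.gateValues x := by
  cases C with
  | input => exact subset_rfl
  | layer mul in₁ in₂ C => exact Set.subset_union_left

theorem Comp.gateValues {n s : ℕ} (C : Circuit n s) (x : Label n → P) :
    Comp (Set.range x) C.size (C.gateValues x) := by
  induction C with
  | input => exact (of_subset subset_rfl).le (Nat.zero_le _)
  | @layer s w mul in₁ in₂ C ih =>
    have h : Comp (Set.range x ∪ C.gateValues x) (Fintype.card (Label s) * 1)
        (Set.range ((Circuit.layer mul in₁ in₂ C).ringEval x)) := by
      refine range _ fun p => ?_
      have h' : ∀ q, Comp (Set.range x ∪ C.gateValues x) 0 {C.ringEval x q} := fun q =>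
        .var (.inr (C.range_ringEval_subset x ⟨q, rfl⟩))
      simp only [Circuit.ringEval]
      split
      · exact (h' _).mul (h' _)
      · exact (h' _).add (h' _)
    refine ((ih.trans h).le ?_).mono subset_rfl (Set.union_comm _ _).subset
    simp [Circuit.size]
    omega

end RingEval

theorem Circuit.ringEval_apply {n s : ℕ} (C : Circuit n s) (x : Label n → Val.{u} N k m) (p : Label s)
    (e : Env.{u} N k m) : C.ringEval x p e = C.eval (fun j => x j e) p := by
  induction C with
  | input => rfl
  | layer mul in₁ in₂ C ih =>
    simp only [ringEval, eval, ← ih]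
    split <;> rfl

theorem extend_apply {l : ℕ} (T : Label l → Val.{u} N k m) (z : Fin l → Val.{u} N k m)
    (e : Env.{u} N k m) : extend T z e = mle (fun p => T p e) (fun i => z i e) := by
  simp only [extend, mle, eqWeight, Finset.sum_apply, Pi.mul_apply, Finset.prod_apply]
  refine Finset.sum_congr rfl fun p _ => congrArg _ (Finset.prod_congr rfl fun i _ => ?_)
  split <;> rfl

/-! ### Reducing a claim about a layer to a claim about the next one -/

/-- The indicator function of the multiplication gates. -/
def mulTable {P : Type*} [CommRing P] {s : ℕ} (mul : Label s → Bool) (p : Label s) : P :=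
  if mul p then 1 else 0

/-- The three values that the verifier prepares for a layer whose coins start with number `t`: the
multilinear extensions of the gate types and of the two wiring predicates at the points that the coins
determine. -/
def layerAdvice (N k m b : ℕ) {s w : ℕ} (mul : Label s → Bool) (in₁ in₂ : Label s → Label w) (t : ℕ) :
    Set (Val.{u} N k m) :=
  {extend (mulTable mul) (coinsFrom t s),
    extend (fun p => eqWeight (coinsFrom (t + (s + b) + 1) w) (in₁ p)) (coinsFrom t s),
    extend (fun p => eqWeight (coinsFrom (t + (s + b) + 1) w) (in₂ p)) (coinsFrom t s)}

theorem gatePart_append {s b : ℕ} (p₁ : Label s) (p₂ : Label b) :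
    gatePart (Fin.append p₁ p₂) = p₁ := by
  funext i
  simp [gatePart]

theorem copyPart_append {s b : ℕ} (p₁ : Label s) (p₂ : Label b) :
    copyPart (Fin.append p₁ p₂) = p₂ := by
  funext i
  simp [copyPart]

section Wiring

variable {P : Type*} [CommRing P]

/-- The layer above `V`: gate `p` takes the values of `V` at `f` of its own gate part, in the same copy. -/
def wire {s w b : ℕ} (f : Label s → Label w) (V : Label (w + b) → P) (p : Label (s + b)) : P :=
  V (Fin.append (f (gatePart p)) (copyPart p))

/-- The values of the gates of `V`, with the copy variables bound to `c`. -/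
def bindCopies {w b : ℕ} (V : Label (w + b) → P) (c : Fin b → P) (ω : Label w) : P :=
  extend (fun p₂ => V (Fin.append ω p₂)) c

theorem extend_wire {s w b : ℕ} (f : Label s → Label w) (V : Label (w + b) → P) (r : Fin s → P)
    (c : Fin b → P) :
    extend (wire f V) (Fin.append r c) = ∑ ω, pullWeight f r ω * bindCopies V c ω := by
  rw [extend_append, ← extend_comp]
  simp only [wire, gatePart_append, copyPart_append]
  rfl

theorem extend_gatePart {s b : ℕ} (T : Label s → P) (r : Fin s → P) (c : Fin b → P) :
    extend (fun p => T (gatePart p)) (Fin.append r c) = extend T r := by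
  rw [extend_append]
  simp only [gatePart_append, extend_const]

theorem extend_zero {l : ℕ} (z : Fin l → P) : extend (fun _ => (0 : P)) z = 0 :=
  extend_const 0 z

end Wiring

/-- The protocol for one layer.  A first sum-check over the gates of the layer ends with claims about the two
wired tables at the same point.  With a coin they are combined into one, which is a sum over the gates of the
next layer, and a second sum-check reduces it to a claim about a single point. -/
theorem Inv.layer {p : List (PreInstr m)} {τ₀ : Val.{u} N k m} {s w b cV cm cP t err : ℕ}
    {AV AP : Set (Val.{u} N k m)} (mul : Label s → Bool) (in₁ in₂ : Label s → Label w)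
    (V : Label (w + b) → Val.{u} N k m) (z : Fin (s + b) → Val.{u} N k m)
    (h : Inv p τ₀ cV cm cP AV AP t
      (extend (fun p => if mul (gatePart p) then wire in₁ V p * wire in₂ V p
        else wire in₁ V p + wire in₂ V p) z) err)
    (hzV : Set.range z ⊆ AV) (hzP : Set.range z ⊆ AP) (hV : Set.range V ⊆ AP)
    (ha : layerAdvice N k m b mul in₁ in₂ t ⊆ AV) (ht : t + (s + b) + 1 + w + 1 ≤ m) :
    Inv p τ₀ (cV + 34 * (s + b + w + 2)) (cm + 6 * (s + b + w + 2))
      (cP + (250 * 2 ^ (s + b) + 240 * 2 ^ (w + b)))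
      (AV ∪ Set.range (Fin.append (coinsFrom (t + (s + b) + 1) w) (coinsFrom (t + s) b)))
      (AP ∪ Set.range (Fin.append (coinsFrom (t + (s + b) + 1) w) (coinsFrom (t + s) b)))
      (t + (s + b) + 1 + w + 1)
      (extend V (Fin.append (coinsFrom (t + (s + b) + 1) w) (coinsFrom (t + s) b)))
      (err + 5 * (s + b + w + 2)) := by
  have hm₀ := ha (by simp [layerAdvice] : extend (mulTable mul) (coinsFrom t s) ∈ _)
  have hm₁ := ha (by simp [layerAdvice] :
    extend (fun p => eqWeight (coinsFrom (t + (s + b) + 1) w) (in₁ p)) (coinsFrom t s) ∈ _)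
  have hm₂ := ha (by simp [layerAdvice] :
    extend (fun p => eqWeight (coinsFrom (t + (s + b) + 1) w) (in₂ p)) (coinsFrom t s) ∈ _)
  clear ha
  set r₁ : Fin s → Val.{u} N k m := coinsFrom t s
  set c : Fin b → Val.{u} N k m := coinsFrom (t + s) b
  have hr : (coinsFrom t (s + b) : Fin (s + b) → Val.{u} N k m) = Fin.append r₁ c :=
    coinsFrom_add t s b
  have hgate : extend (fun p => if mul (gatePart p) then wire in₁ V p * wire in₂ V p
        else wire in₁ V p + wire in₂ V p) z =
      ∑ p, phi (eqWeight z p) (mulTable mul (gatePart p)) (wire in₁ V p) (wire in₂ V p) := by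
    refine Finset.sum_congr rfl fun p _ => ?_
    unfold phi mulTable
    by_cases hp : mul (gatePart p) = true
    · simp only [if_pos hp]
      ring
    · simp only [if_neg hp]
      ring
  rw [hgate] at h
  -- the first sum-check
  have hwire : ∀ (f : Label s → Label w), Set.range (wire f V) ⊆ AP := by
    rintro f _ ⟨p, rfl⟩
    exact hV ⟨_, rfl⟩
  have h₁ := ((h.compP (Comp.eqWeight hzP)).compP (Comp.zero.union Comp.one)).sumcheck
    (fun v hv => .inl (.inr hv))
    (by
      rintro _ ⟨p, rfl⟩
      refine .inr ?_
      dsimp only [mulTable]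
      split
      · exact .inr rfl
      · exact .inl rfl)
    (fun v hv => .inl (.inl (hwire in₁ hv))) (fun v hv => .inl (.inl (hwire in₂ hv))) (by omega)
  rw [extend_eqWeight, hr, extend_gatePart] at h₁
  -- the two claims about the wired tables
  set L := extend (wire in₁ V) (Fin.append r₁ c) with hL
  set R := extend (wire in₂ V) (Fin.append r₁ c) with hR
  set Ez := ∏ i, (z i * Fin.append r₁ c i + (1 - z i) * (1 - Fin.append r₁ c i)) 
  have hEzC : Comp (AV ∪ Set.range (Fin.append r₁ c)) ((s + b) * 8 + 1) {Ez} := by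
    have := Comp.prod (c := 7) (A := AV ∪ Set.range (Fin.append r₁ c)) Finset.univ
      (fun i => z i * Fin.append r₁ c i + (1 - z i) * (1 - Fin.append r₁ c i)) fun i _ =>
        (((Comp.var (.inl (hzV ⟨i, rfl⟩))).mul (Comp.var (.inr ⟨i, rfl⟩))).add
          ((Comp.one.sub (Comp.var (.inl (hzV ⟨i, rfl⟩)))).mul
            (Comp.one.sub (Comp.var (.inr ⟨i, rfl⟩))))).le (by norm_num)
    simpa using this
  have h₂ := (h₁.compV hEzC).exchange (j := 2) (d := 7) (by omega) ![L, R]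
    (by
      rintro _ ⟨i, rfl⟩
      refine .inr ?_
      fin_cases i
      · exact .inl rfl
      · exact .inr rfl)
    (fun e μ => phi (Ez e) (extend (mulTable mul) r₁ e) (μ 0) (μ 1)) (fun e => rfl)
    (fun μ => (by
      have hE : Comp (AV ∪ Set.range (Fin.append r₁ c) ∪ {Ez} ∪ Set.range μ) 0 {Ez} :=
        .var (.inl (.inr rfl))
      have hM : Comp (AV ∪ Set.range (Fin.append r₁ c) ∪ {Ez} ∪ Set.range μ) 0
        {extend (mulTable mul) r₁} := .var (.inl (.inl (.inl hm₀)))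
      have h0 : Comp (AV ∪ Set.range (Fin.append r₁ c) ∪ {Ez} ∪ Set.range μ) 0 {μ 0} :=
        .var (.inr ⟨0, rfl⟩)
      have h1 : Comp (AV ∪ Set.range (Fin.append r₁ c) ∪ {Ez} ∪ Set.range μ) 0 {μ 1} :=
        .var (.inr ⟨1, rfl⟩)
      exact hE.mul ((hM.mul ((h0.mul h1).sub (h0.add h1))).add (h0.add h1))))
  set γ : Val.{u} N k m := coin (t + (s + b))
  set r' : Fin w → Val.{u} N k m := coinsFrom (t + (s + b) + 1) w
  -- the combined claim as a sum over the gates of the next layer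
  have hnext : ∑ i, (![L, R] : Fin 2 → Val.{u} N k m) i * γ ^ (i : ℕ) =
      ∑ ω, phi (pullWeight in₁ r₁ ω + γ * pullWeight in₂ r₁ ω) ((fun _ => 0 : Label w → _) ω)
        (bindCopies V c ω) ((fun _ => 0 : Label w → _) ω) := by
    rw [Fin.sum_univ_two]
    simp only [Matrix.cons_val_zero, Matrix.cons_val_one, hL, hR, extend_wire, phi, Finset.sum_mul,
      ← Finset.sum_add_distrib, Fin.val_zero, Fin.val_one]
    exact Finset.sum_congr rfl fun ω _ => by ring
  rw [hnext] at h₂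
  set AP₁ := insert γ (AP ∪ Set.range (eqWeight z) ∪ ({0} ∪ {1}) ∪ Set.range (Fin.append r₁ c) ∪
    {L, R}) with hAP₁
  have hrP : Set.range (Fin.append r₁ c) ⊆ AP₁ := fun v hv => .inr (.inl (.inr hv))
  rw [range_append] at hrP
  have hP₁ : Comp AP₁ (2 ^ s * 4) (Set.range (eqWeight r₁)) :=
    Comp.eqWeight (Set.subset_union_left.trans hrP)
  have hP₂ : Comp AP₁ (2 ^ s * 4 + (2 ^ s + 2 ^ w + (2 ^ s + 2 ^ w)))
      (Set.range (pullWeight in₁ r₁) ∪ Set.range (pullWeight in₂ r₁)) :=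
    hP₁.trans' ((Comp.pullWeight in₁ Set.subset_union_right).union
      (Comp.pullWeight in₂ Set.subset_union_right))
  have hP₃ : Comp AP₁ (2 ^ s * 4 + (2 ^ s + 2 ^ w + (2 ^ s + 2 ^ w)) + Fintype.card (Label w) * 2)
      (Set.range fun ω => pullWeight in₁ r₁ ω + γ * pullWeight in₂ r₁ ω) :=
    hP₂.trans' (Comp.range (c := 2) _ fun ω =>
      (Comp.var (.inr (.inl ⟨ω, rfl⟩))).add ((Comp.var (.inl (.inl rfl))).mul
        (Comp.var (.inr (.inr ⟨ω, rfl⟩)))))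
  have hP₄ : Comp AP₁ (Fintype.card (Label w) * (2 ^ b * 3)) (Set.range (bindCopies V c)) :=
    Comp.range _ fun ω => Comp.extend
      (by
        rintro _ ⟨p₂, rfl⟩
        exact .inr (.inl (.inl (.inl (.inl (hV ⟨_, rfl⟩))))))
      (Set.subset_union_right.trans hrP)
  have h0P : (Set.range fun _ : Label w => (0 : Val.{u} N k m)) ⊆ AP₁ := by
    rintro _ ⟨_, rfl⟩
    exact .inr (.inl (.inl (.inr (.inl rfl))))
  have h₃ := ((h₂.compP hP₃).compP (hP₄.mono Set.subset_union_left subset_rfl)).sumcheck (fun v hv => .inl (.inr hv))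
    (fun v hv => .inl (.inl (h0P hv))) (fun v hv => .inr hv) (fun v hv => .inl (.inl (h0P hv)))
    (by omega)
  rw [extend_add_mul, extend_pullWeight, extend_pullWeight, extend_zero] at h₃
  -- the last claim
  set W := extend (fun p => eqWeight r' (in₁ p)) r₁ + γ * extend (fun p => eqWeight r' (in₂ p)) r₁
  have hWC : Comp (insert γ (AV ∪ Set.range (Fin.append r₁ c) ∪ {Ez}) ∪ Set.range r') 2 {W} :=
    (Comp.var (.inl (.inr (.inl (.inl hm₁))))).add ((Comp.var (.inl (.inl rfl))).mul
      (Comp.var (.inl (.inr (.inl (.inl hm₂))))))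
  have h₄ := (h₃.compV hWC).exchange (j := 1) (d := 1) (by omega) ![extend (bindCopies V c) r']
    (by
      rintro _ ⟨i, rfl⟩
      fin_cases i
      exact .inr (.inl rfl))
    (fun e μ => W e * μ 0)
    (fun e => congrFun (phi_zero_zero W (extend (bindCopies V c) r')) e)
    (fun μ => (Comp.var (.inl (.inr rfl)) : Comp _ 0 {W}).mul (Comp.var (.inr ⟨0, rfl⟩)))
  have hlast : ∑ i, (![extend (bindCopies V c) r'] : Fin 1 → Val.{u} N k m) i *
      coin (t + (s + b) + 1 + w) ^ (i : ℕ) = extend V (Fin.append r' c) := by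
    rw [extend_append]
    simp
    rfl
  rw [hlast] at h₄
  refine h₄.mono (by omega) (by omega) ?_ (by omega) ?_ ?_
  · have h1 : 2 ^ s ≤ 2 ^ (s + b) := Nat.pow_le_pow_right (by norm_num) (by omega)
    have h2 : 2 ^ w ≤ 2 ^ (w + b) := Nat.pow_le_pow_right (by norm_num) (by omega)
    have h3 : 2 ^ w * (2 ^ b * 3) = 3 * 2 ^ (w + b) := by rw [pow_add]; ring
    have h4 : 1 ≤ 2 ^ s := Nat.one_le_two_pow
    have h5 : Fintype.card (Label w) = 2 ^ w := by simp
    rw [h5, h3]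
    omega
  · rw [range_append, range_append]
    intro v hv
    simp only [Set.mem_union, Set.mem_insert_iff] at hv ⊢
    tauto
  · rw [hAP₁, range_append, range_append]
    intro v hv
    simp only [Set.mem_union, Set.mem_insert_iff] at hv ⊢
    tauto

/-! ### The protocol for a circuit -/

/-- Number of coins that the protocol for `2 ^ b` copies of the circuit uses. -/
def Circuit.numCoins {n : ℕ} (b : ℕ) : {s : ℕ} → Circuit n s → ℕ
  | _, .input => 0
  | s, .layer (t := w) _ _ _ C => s + b + w + 2 + C.numCoins b

/-- What the verifier prepares for `2 ^ b` copies of the circuit, when the coins start with number `t`. -/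
def Circuit.advice (N k m b : ℕ) {n : ℕ} : {s : ℕ} → Circuit n s → ℕ → Set (Val.{u} N k m)
  | _, .input, _ => ∅
  | s, .layer (t := w) mul in₁ in₂ C, t =>
      layerAdvice N k m b mul in₁ in₂ t ∪ C.advice N k m b (t + (s + b) + 1 + w + 1)

theorem Circuit.two_pow_le_size {n s : ℕ} (C : Circuit n s) : 2 ^ s ≤ C.size := by
  cases C with
  | input => exact le_rfl
  | layer mul in₁ in₂ C => exact Nat.le_add_right _ _

theorem Circuit.two_pow_input_le_size {n s : ℕ} (C : Circuit n s) : 2 ^ n ≤ C.size := by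
  induction C with
  | input => exact le_rfl
  | layer mul in₁ in₂ C ih => exact ih.trans (Nat.le_add_left _ _)

theorem Circuit.one_le_depth {n s : ℕ} (C : Circuit n s) : 1 ≤ C.depth := by
  cases C with
  | input => exact le_rfl
  | layer mul in₁ in₂ C => exact Nat.le_add_left _ _

theorem Circuit.numCoins_le {n s b D : ℕ} (C : Circuit n s) (h : 2 ^ b * C.size < 2 ^ (D + 1)) :
    C.numCoins b ≤ (2 * D + 2) * C.depth := by
  induction C with
  | input => exact Nat.zero_le _
  | @layer s w mul in₁ in₂ C ih =>
    have h₁ : ∀ j : ℕ, 2 ^ j ≤ (Circuit.layer mul in₁ in₂ C).size → j + b ≤ D := fun j hj => by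
      refine Nat.lt_succ_iff.mp ((Nat.pow_lt_pow_iff_right (a := 2) (by norm_num)).mp
        (lt_of_le_of_lt ?_ h))
      rw [pow_add, mul_comm]
      exact Nat.mul_le_mul_left _ hj
    have h₂ := h₁ s (two_pow_le_size _)
    have h₃ := h₁ w (C.two_pow_le_size.trans (Nat.le_add_left _ _))
    have h₄ := ih (lt_of_le_of_lt (Nat.mul_le_mul_left _ (Nat.le_add_left _ _)) h)
    simp only [numCoins, depth]
    rw [mul_add]
    omega

theorem Pre.layerAdvice {s w b c t : ℕ} {A : Set (Val.{u} N k m)} (h : Pre c A)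
    (mul : Label s → Bool) (in₁ in₂ : Label s → Label w) (ht : t + (s + b) + 1 + w + 1 ≤ m) :
    Pre (c + (12 * 2 ^ s + 5 * 2 ^ w)) (A ∪ DataParallel.layerAdvice N k m b mul in₁ in₂ t) := by
  have h₁ := ((h.coins (fun i : Fin s => t + i) fun i => by omega).coins
    (fun i : Fin w => t + (s + b) + 1 + i) fun i => by omega).comp (Comp.zero.union Comp.one)
  set X := A ∪ (Set.range fun i : Fin s => (coin (t + i) : Val.{u} N k m)) ∪
    (Set.range fun i : Fin w => coin (t + (s + b) + 1 + i)) ∪ ({0} ∪ {1})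
  have hs : Set.range (coinsFrom t s) ⊆ X := fun v hv => .inl (.inl (.inr hv))
  have hw : Set.range (coinsFrom (t + (s + b) + 1) w) ⊆ X := fun v hv => .inl (.inr hv)
  have hmul : Set.range (mulTable mul) ⊆ X := by
    rintro _ ⟨p, rfl⟩
    refine .inr ?_
    unfold mulTable
    split
    · exact .inr rfl
    · exact .inl rfl
  have hin : ∀ f : Label s → Label w,
      Comp (X ∪ Set.range (eqWeight (coinsFrom (t + (s + b) + 1) w))) (2 ^ s * 3)
        {extend (fun p => eqWeight (coinsFrom (t + (s + b) + 1) w) (f p)) (coinsFrom t s)} := by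
    intro f
    refine Comp.extend ?_ (hs.trans Set.subset_union_left)
    rintro _ ⟨p, rfl⟩
    exact .inr ⟨_, rfl⟩
  have h₂ := h₁.comp ((Comp.extend hmul hs).union
    ((Comp.eqWeight hw).trans' ((hin in₁).union (hin in₂))))
  obtain ⟨p, hp, hst⟩ := h₂
  refine ⟨p, hp.trans ?_, hst.mono ?_⟩
  · have hs := Nat.lt_two_pow_self (n := s)
    have hw := Nat.lt_two_pow_self (n := w)
    omega
  · rintro v (hv | hv)
    · exact .inl (.inl (.inl (.inl hv)))
    · exact .inr hv

/-- The verifier can prepare the advice in time linear in the size of one copy.  A layer also pays for a table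
indexed by the next one; the summand `5 * 2 ^ s` is what the layer above pays for this layer. -/
theorem Pre.advice {n b : ℕ} {s : ℕ} (C : Circuit n s) : ∀ {c t : ℕ} {A : Set (Val.{u} N k m)},
    Pre c A → t + C.numCoins b ≤ m →
      ∃ q, q + 5 * 2 ^ s ≤ 17 * C.size ∧ Pre (c + q) (A ∪ C.advice N k m b t) := by
  induction C with
  | input =>
    intro c t A h _
    refine ⟨0, ?_, by simpa [Circuit.advice] using h⟩
    simp only [Circuit.size]
    omega
  | @layer s w mul in₁ in₂ C ih =>
    intro c t A h ht
    simp only [Circuit.numCoins] at ht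
    obtain ⟨q, hq, h'⟩ := ih (h.layerAdvice (b := b) mul in₁ in₂ (t := t) (by omega))
      (t := t + (s + b) + 1 + w + 1) (by omega)
    refine ⟨12 * 2 ^ s + 5 * 2 ^ w + q, ?_, ?_⟩
    · simp only [Circuit.size]
      omega
    · rw [← add_assoc, Circuit.advice, ← Set.union_assoc]
      exact h'

/-- The protocol reduces a claim about the output layer to a claim about the input.  A layer
also pays for tables over the next one; in the bound on the prover's time `q`, the summand `240 * 2 ^ (s + b)` is
what the layer above pays for this layer. -/
theorem Inv.circuit {p : List (PreInstr m)} {τ₀ : Val.{u} N k m} {n b : ℕ}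
    (X : Label (n + b) → Val.{u} N k m) {s : ℕ} (C : Circuit n s) :
    ∀ {cV cm cP t err : ℕ} {AV AP : Set (Val.{u} N k m)} (z : Fin (s + b) → Val.{u} N k m),
      Inv p τ₀ cV cm cP AV AP t (extend ((C.copies b).ringEval X) z) err →
      Set.range z ⊆ AV → Set.range z ⊆ AP → (C.copies b).gateValues X ⊆ AP →
      C.advice N k m b t ⊆ AV → t + C.numCoins b ≤ m →
      ∃ (q t' : ℕ) (BV BP : Set (Val.{u} N k m)) (z' : Fin (n + b) → Val.{u} N k m),
        q + 240 * 2 ^ (s + b) ≤ 490 * (2 ^ b * C.size) ∧ AV ⊆ BV ∧ Set.range z' ⊆ BV ∧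
        Inv p τ₀ (cV + 34 * C.numCoins b) (cm + 6 * C.numCoins b) (cP + q) BV BP t' (extend X z')
          (err + 5 * C.numCoins b) := by
  induction C with
  | input =>
    intro cV cm cP t err AV AP z h hzV hzP hg ha ht
    refine ⟨0, t, AV, AP, z, ?_, subset_rfl, hzV, h⟩
    simp only [Circuit.size]
    rw [pow_add, mul_comm (2 ^ n)]
    omega
  | @layer s w mul in₁ in₂ C ih =>
    intro cV cm cP t err AV AP z h hzV hzP hg ha ht
    simp only [Circuit.numCoins] at ht
    have h₁ := Inv.layer mul in₁ in₂ ((C.copies b).ringEval X) z h hzV hzP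
      (((C.copies b).range_ringEval_subset X).trans (Set.subset_union_right.trans hg))
      (Set.subset_union_left.trans ha) (by omega)
    obtain ⟨q, t', BV, BP, z', hq, hB, hz', h₂⟩ := ih _ h₁ Set.subset_union_right
      Set.subset_union_right ((Set.subset_union_right.trans hg).trans Set.subset_union_left)
      ((Set.subset_union_right.trans ha).trans Set.subset_union_left) (by omega)
    refine ⟨250 * 2 ^ (s + b) + 240 * 2 ^ (w + b) + q, t', BV, BP, z', ?_,
      Set.subset_union_left.trans hB, hz', ?_⟩
    · simp only [Circuit.size]
      have : 2 ^ b * (2 ^ s + C.size) = 2 ^ (s + b) + 2 ^ b * C.size := by ring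
      omega
    · simp only [Circuit.numCoins]
      exact h₂.mono (by omega) (by omega) (by omega) (by omega) subset_rfl subset_rfl

/-- The protocol, with costs in terms of the number of coins. -/
theorem exists_protocol {n s : ℕ} (C : Circuit n s) (b : ℕ) :
    ∃ (V : Verifier (n + b) (s + b)) (P : ProverProgram (n + b) (s + b)),
      V.preTime ≤ 17 * C.size ∧
      V.onlineTime ≤ 4 * 2 ^ (n + b) + (s + b) + 34 * C.numCoins b + 4 ∧
      P.time ≤ 500 * (2 ^ b * C.size) ∧
      V.communication ≤ 1 + 6 * C.numCoins b ∧
      ∀ (F : Type u) [Field F] [Finite F], 15 * C.numCoins b ≤ Nat.card F →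
        ∀ z : Fin (s + b) → F,
          IsValidProtocol (P.strategy z) V z (fun x => mle ((C.copies b).eval x) z) := by
  let X : Label (n + b) → Val.{u} (n + b) (s + b) (C.numCoins b) := fun j e => e.x j
  let Z : Fin (s + b) → Val.{u} (n + b) (s + b) (C.numCoins b) := fun i e => e.z i
  have hτ : (fun e : Env.{u} (n + b) (s + b) (C.numCoins b) => mle ((C.copies b).eval e.x) e.z) =
      extend ((C.copies b).ringEval X) Z := by
    funext e
    rw [extend_apply]
    simp only [Circuit.ringEval_apply]
    rfl
  obtain ⟨q, hq, p, hp, hst⟩ := Pre.advice (b := b) C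
    (Pre.nil (N := n + b) (k := s + b) (m := C.numCoins b)) (t := 0) (by omega)
  have hcomp : Comp (Set.range Z ∪ Set.range X) ((C.copies b).size + 2 ^ (s + b) * 3)
      ((C.copies b).gateValues X ∪ {extend ((C.copies b).ringEval X) Z}) :=
    ((Comp.gateValues (C.copies b) X).mono Set.subset_union_right subset_rfl).trans
      (Comp.extend (((C.copies b).range_ringEval_subset X).trans Set.subset_union_right)
        (Set.subset_union_left.trans Set.subset_union_left))
  have h₀ := Inv.init hst hcomp (.inr rfl)
  obtain ⟨q', t', BV, BP, z', hq', hB, hz', h₁⟩ := Inv.circuit X C Z h₀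
    (fun v hv => .inr (.inl hv)) (fun v hv => .inl (.inl hv)) (fun v hv => .inr (.inl hv))
    (fun v hv => .inl (.inr hv)) (by omega)
  have hX : Set.range X ⊆ BV := fun v hv => hB (.inr (.inr hv))
  rw [← hτ] at h₁
  obtain ⟨V, P, hV₁, hV₂, hP, hV₃, hF⟩ := Inv.finish
    (fun F _ z x => mle ((C.copies b).eval x) z) h₁ (Comp.extend hX hz')
  refine ⟨V, P, ?_, ?_, ?_, ?_, fun F _ _ hc z => hF F (by omega) z⟩
  · omega
  · omega
  · rw [Circuit.size_copies] at hP
    have h₂ : 2 ^ (s + b) ≤ 2 ^ b * C.size := by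
      rw [pow_add, mul_comm]
      exact Nat.mul_le_mul_left _ C.two_pow_le_size
    have h₃ : 2 ^ (n + b) ≤ 2 ^ b * C.size := by
      rw [pow_add, mul_comm]
      exact Nat.mul_le_mul_left _ C.two_pow_input_le_size
    have h₄ := Nat.lt_two_pow_self (n := s + b)
    omega
  · omega

end DataParallel

open DataParallel in
/-- There are absolute constants `K` and `K₀` such that, for every layered arithmetic circuit `C` of
size `S ≥ 2` and depth `d` and every `B = 2 ^ b`, there are programs for the verifier and the prover,
within the stated costs, that form a valid interactive proof protocol for the value at `z` of the
multilinear extension of the output layer of `B` copies of `C`, for every point `z` over every finite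
field with at least `K₀ * d * log (B * S)` elements.  Here `n* = 2 ^ (n + b)` is the number of inputs
of the `B` copies. -/
theorem theorem2 :
    ∃ K K₀ : ℕ, ∀ (n s : ℕ) (C : Circuit n s) (b : ℕ), 2 ≤ C.size →
      ∃ (V : Verifier (n + b) (s + b)) (P : ProverProgram (n + b) (s + b)),
        V.preTime ≤ K * C.size ∧
        V.onlineTime ≤ K * (2 ^ (n + b) * Nat.log 2 (2 ^ (n + b)) +
          C.depth * Nat.log 2 (2 ^ b * C.size)) ∧
        P.time ≤ K * (C.size * 2 ^ b * Nat.log 2 C.size) ∧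
        V.communication ≤ K * (C.depth * Nat.log 2 (2 ^ b * C.size)) ∧
        ∀ (F : Type*) [Field F] [Finite F],
          K₀ * (C.depth * Nat.log 2 (2 ^ b * C.size)) ≤ Nat.card F →
          ∀ z : Fin (s + b) → F,
            IsValidProtocol (P.strategy z) V z (fun x => mle ((C.copies b).eval x) z) := by
  refine ⟨500, 60, fun n s C b hC => ?_⟩
  obtain ⟨V, P, hV₁, hV₂, hP, hV₃, hF⟩ := exists_protocol C b
  set D := Nat.log 2 (2 ^ b * C.size) with hD
  have hpos : 0 < 2 ^ b * C.size := by positivity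
  have hlog : 1 ≤ Nat.log 2 C.size := Nat.log_pos (by norm_num) hC
  have hD₁ : 1 ≤ D := hlog.trans (Nat.log_mono_right (Nat.le_mul_of_pos_left _ (by positivity)))
  have hcoins := C.numCoins_le (b := b) (D := D) (Nat.lt_pow_succ_log_self (by norm_num) _)
  have hd := C.one_le_depth
  have hdD : D ≤ C.depth * D := Nat.le_mul_of_pos_left _ hd
  have hdd : C.depth ≤ C.depth * D := Nat.le_mul_of_pos_right _ hD₁
  have hcoins' : C.numCoins b ≤ 4 * (C.depth * D) := by
    have : (2 * D + 2) * C.depth = 2 * (C.depth * D) + 2 * C.depth := by ring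
    omega
  refine ⟨V, P, by omega, ?_, ?_, by omega, fun F _ _ hc z => hF F (by omega) z⟩
  · rw [Nat.log_pow (by norm_num)]
    have hsb : s + b ≤ D := by
      rw [hD]
      refine Nat.le_log_of_pow_le (by norm_num) ?_
      rw [pow_add, mul_comm]
      exact Nat.mul_le_mul_left _ C.two_pow_le_size
    -- a circuit with a single input needs the second summand
    have hn : 2 ^ (n + b) ≤ 2 ^ (n + b) * (n + b) + C.depth * D := by
      rcases Nat.eq_zero_or_pos (n + b) with h | h
      · rw [h]
        omega
      · exact (Nat.le_mul_of_pos_right _ h).trans (Nat.le_add_right _ _)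
    omega
  · have : 2 ^ b * C.size ≤ C.size * 2 ^ b * Nat.log 2 C.size := by
      rw [mul_comm (2 ^ b)]
      exact Nat.le_mul_of_pos_right _ hlog
    omega
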